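/- **Definitions.** For a DAG $G$ on a finite vertex set $V$, let $\mathcal M(G)$ be the set of joint distributions of real random variables $(X_v)_{v\in V}$ for which every $X_v$ is conditionally independent of its non-descendants given its parents. $G$ and $H$ are *Markov equivalent* if $\mathcal M(G)=\mathcal M(H)$. Let $G^{(i)}$ be $G$ with all edges into $i$ deleted. For $I\subseteq V$, the *$I$-Markov equivalence class* ($I$-MEC) of $G$ consists of all DAGs $H$ that are Markov equivalent to $G$ and for which $H^{(i)}$ and $G^{(i)}$ are Markov equivalent for all $i\in I$. An edge of $G$ is *unoriented* in the $I$-essential graph $\mathrm{Ess}(G,I)$ if it does not have the same orientation in all members of the $I$-MEC. Let $0<\rho<1$. $G_n\sim \mathrm{orderDAG}(n,\rho)$ is an Erdős–Rényi graph on $n$ vertices with edge probability $\rho$, oriented along an independent uniformly random total order of the vertices. Let $r\ge 0$; below $I$ ranges over the sets of $r$ vertices (over $I=V$ only, if $r>n$). * $X_n(r)$ is the minimum over $I$ of the number of unoriented edges in $\mathrm{Ess}(G_n,I)$; call $I$ *edge-optimal* if it attains this minimum. * $I_n$ is the least size of a set $I\subseteq V$ for which $\mathrm{Ess}(G_n,I)$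 has no unoriented edge. * $L_n(r)$ is the minimum over $I$ of the size of the $I$-MEC of $G_n$. * $isuEss_n(r)$ is $1$ if $X_n(r)=0$ and $0$ otherwise. Couple the $G_n$ through one array of independent Bernoulli($\rho$) variables $A_{i,j}$, $i<j$: $G_n$ has vertices $v_1,\dots,v_n$ and an edge $v_i\to v_j$ if and only if $i<j$ and $A_{i,j}=1$. Up to a uniformly random relabelling of the vertices this is $\mathrm{orderDAG}(n,\rho)$. **Theorem.** Under this coupling the almost sure limits $X_\infty(r)$, $I_\infty$, $L_\infty(r)$, $isuEss_\infty(r)$ of these metrics as $n\to\infty$ exist, and $X_\infty(r)$, $I_\infty$, $\log_2L_\infty(r)$, $isuEss_\infty(r)$ are integrable. For all $n\ge 0$ and $r\ge 0$, \begin{align*} E[X_n(r)] &\le E[X_\infty(r)] \le E[X_n(r)]+\epsilon_n,\\ E[I_n] &\le E[I_\infty] \le E[I_n]+\epsilon_n,\\ E[\log_2 L_n(r)] &\le E[\log_2 L_\infty(r)] \le E[X_\infty(r)],\\ E[isuEss_n(r)] &\ge E[isuEss_\infty(r)] \ge E[isuEss_n(r)]-\epsilon_n, \end{align*} where the convergent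 series $\epsilon_n$ satisfies $$\epsilon_n=\sum_{i\ge n}\rho\, i\,(1-\rho(1-\rho))^{i-1}\le \frac{(1-\rho(1-\rho))^n}{\rho(1-\rho)^2}+n\,\frac{(1-\rho(1-\rho))^{n-1}}{1-\rho},$$ and the right-hand side is at most $Cq^n$ for all $n$, with some $C$ and some $q<1$ that depend only on $\rho$. Moreover, the third line also holds with $L_\infty(r)$ replaced by the limit for edge-optimal interventions: for every rule $S$ that selects an edge-optimal set $S(G_n)$ for every DAG, and every almost sure limit $M$ of the sizes of the $S(G_n)$-MECs of $G_n$, one has $L_\infty(r)\le M$ almost surely, $\log_2M$ is integrable, and $E[\log_2 L_n(r)]\le E[\log_2 M]\le E[X_\infty(r)]$ for all $n$. Rules $S$ for which such a limit $M$ exists do exist. -/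

import Mathlib

open MeasureTheory ProbabilityTheory Filter Topology

noncomputable section

/-- A directed acyclic graph with vertex set `V`. -/
structure DAG (V : Type*) extends Digraph V where
  acyclic : ∀ v, ¬ Relation.TransGen Adj v v

namespace DAG

variable {V : Type*}

/-- The parents of `v`. -/
def parents (G : DAG V) (v : V) : Set V := {u | G.Adj u v}

/-- The non-descendants of `v` (a vertex does not count as its own non-descendant). -/
def nonDescendants (G : DAG V) (v : V) : Set V :=
  {w | ¬ Relation.ReflTransGen G.Adj v w}

/-- The projection of a configuration of all variables to the variables in `S`. -/
def proj (S : Set V) (x : V → ℝ) : S → ℝ := fun w => x w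

lemma measurable_proj (S : Set V) : Measurable (proj S) :=
  measurable_pi_lambda _ fun w => measurable_pi_apply (w : V)

/-- The joint distribution `P` of the real random variables `(X_v)` is Markov with respect to `G`:
each `X_v` is conditionally independent of its non-descendants given its parents. -/
def IsMarkov [Finite V] (G : DAG V) (P : Measure (V → ℝ)) [IsProbabilityMeasure P] : Prop :=
  ∀ v : V, CondIndepFun (MeasurableSpace.comap (proj (G.parents v)) inferInstance)
    (measurable_proj (G.parents v)).comap_le
    (fun x : V → ℝ => x v) (proj (G.nonDescendants v)) P

/-- Markov equivalence: the same joint distributions are Markov with respect to both DAGs. -/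
def MarkovEquiv [Finite V] (G H : DAG V) : Prop :=
  ∀ (P : Measure (V → ℝ)) [IsProbabilityMeasure P], G.IsMarkov P ↔ H.IsMarkov P

/-- The intervened DAG `G^{(i)}`: all edges into `i` are deleted. -/
def intervene (G : DAG V) (i : V) : DAG V where
  Adj a b := G.Adj a b ∧ b ≠ i
  acyclic v h := G.acyclic v
    (Relation.TransGen.mono (p := G.Adj) (fun _ _ hab => And.left hab) v v h)

/-- The `I`-Markov equivalence class of `G`, from observational data together with the single
node interventions at the vertices of `I`. For `I = ∅` it is the Markov equivalence class. -/
def iMEC [Finite V] (G : DAG V) (I : Finset V) : Set (DAG V) :=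
  {H | MarkovEquiv G H ∧ ∀ i ∈ I, MarkovEquiv (G.intervene i) (H.intervene i)}

/-- The edge `a → b` of `G` is directed in the `I`-essential graph: it has this orientation in
all members of the `I`-Markov equivalence class. -/
def EssDirected [Finite V] (G : DAG V) (I : Finset V) (a b : V) : Prop :=
  G.Adj a b ∧ ∀ H ∈ G.iMEC I, H.Adj a b

/-- The edges of `G` that are unoriented in the `I`-essential graph. -/
def unorientedEdges [Finite V] (G : DAG V) (I : Finset V) : Set (V × V) :=
  {e | G.Adj e.1 e.2 ∧ ¬ G.EssDirected I e.1 e.2}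

/-- The number of unoriented edges in the `I`-essential graph. -/
def numUnoriented [Finite V] (G : DAG V) (I : Finset V) : ℕ := (G.unorientedEdges I).ncard

/-- The number of DAGs in the `I`-Markov equivalence class. -/
def classSize [Finite V] (G : DAG V) (I : Finset V) : ℕ := (G.iMEC I).ncard

variable [Fintype V]

/-- The admissible sets of `r` interventions; if there are fewer than `r` vertices, only the set of
all vertices is admissible. -/
def IsInterventionSet (V : Type*) [Fintype V] (r : ℕ) (I : Finset V) : Prop :=
  I.card = min r (Fintype.card V)

/-- `X(r)`: the minimum number of unoriented edges after `r` interventions. -/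
def minUnoriented (G : DAG V) (r : ℕ) : ℕ :=
  sInf {m | ∃ I, IsInterventionSet V r I ∧ m = G.numUnoriented I}

/-- The number of single node interventions that are required to orient `G` fully. -/
def numInterventions (G : DAG V) : ℕ :=
  sInf {m | ∃ I : Finset V, I.card = m ∧ G.numUnoriented I = 0}

/-- `isuEss(r)`: equal to `1` if `X(r) = 0`, and to `0` otherwise. -/
def isuEss (G : DAG V) (r : ℕ) : ℕ := if G.minUnoriented r = 0 then 1 else 0

/-- `L(r)`: the minimum size of the `I`-Markov equivalence class after `r` interventions. -/
def minClassSize (G : DAG V) (r : ℕ) : ℕ :=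
  sInf {m | ∃ I, IsInterventionSet V r I ∧ m = G.classSize I}

/-- `I` is a set of `r` interventions that minimizes the number of unoriented edges. -/
def IsEdgeOptimal (G : DAG V) (r : ℕ) (I : Finset V) : Prop :=
  IsInterventionSet V r I ∧ G.numUnoriented I = G.minUnoriented r

end DAG

/-- Orient the edges of the undirected graph `H` according to the total order in which the vertex
`v` has position `σ v`. -/
def orientBy {n : ℕ} (H : SimpleGraph (Fin n)) (σ : Equiv.Perm (Fin n)) : DAG (Fin n) where
  Adj a b := H.Adj a b ∧ σ a < σ b
  acyclic v h := by
    have key : ∀ a b, Relation.TransGen (fun a b => H.Adj a b ∧ σ a < σ b) a b → σ a < σ b := by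
      intro a b hab
      induction hab with
      | single h => exact h.2
      | tail _ h ih => exact ih.trans h.2
    exact lt_irrefl _ (key v v h)

/-- The expectation of `f (G_n)` for `G_n ∼ orderDAG(n, ρ)`: the skeleton is an Erdős-Rényi graph
with edge probability `ρ`, and independently the order is uniform among all `n!` orders. -/
def orderDAGExp (ρ : unitInterval) (n : ℕ) (f : DAG (Fin n) → ℝ) : ℝ :=
  (∑ σ : Equiv.Perm (Fin n), ∫ H, f (orientBy H σ) ∂(SimpleGraph.binomialRandom (Fin n) ρ))
    / (n.factorial : ℝ)

/-- The DAG on the first `n` vertices with an edge `i → j` exactly if `i < j` and `a i j = true`.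
A single array `a` couples these DAGs for all `n`. -/
def arrayDAG (a : ℕ → ℕ → Bool) (n : ℕ) : DAG (Fin n) where
  Adj i j := i < j ∧ a i j = true
  acyclic v h := by
    have key : ∀ i j, Relation.TransGen (fun i j : Fin n => i < j ∧ a i j = true) i j → i < j := by
      intro i j hij
      induction hij with
      | single h => exact h.1
      | tail _ h ih => exact ih.trans h.1
    exact lt_irrefl _ (key v v h)

/-- The entries `A i j`, `i < j`, are independent random bits, each equal to `true` with
probability `ρ`. -/
structure IsEdgeArray {Ω : Type*} [MeasurableSpace Ω] (P : Measure Ω) (ρ : unitInterval)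
    (A : ℕ → ℕ → Ω → Bool) : Prop where
  measurable : ∀ i j, i < j → Measurable (A i j)
  prob : ∀ i j, i < j → P {ω | A i j ω = true} = ENNReal.ofReal (ρ : ℝ)
  indep : iIndepFun (fun (p : {p : ℕ × ℕ // p.1 < p.2}) => A p.1.1 p.1.2) P

/-- The coupled random DAG `G_n`. -/
def coupledDAG {Ω : Type*} (A : ℕ → ℕ → Ω → Bool) (n : ℕ) (ω : Ω) : DAG (Fin n) :=
  arrayDAG (fun i j => A i j ω) n

/-- `F` is the almost sure limit, under the coupling, of the metrics `f n (G_n)`. -/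
def IsLimitMetric {Ω : Type*} [MeasurableSpace Ω] (P : Measure Ω) (A : ℕ → ℕ → Ω → Bool)
    (f : ∀ n, DAG (Fin n) → ℝ) (F : Ω → ℝ) : Prop :=
  ∀ᵐ ω ∂P, Tendsto (fun n => f n (coupledDAG A n ω)) atTop (𝓝 (F ω))

/-- `RHS(ρ, i) = ρ i (1 - ρ (1 - ρ)) ^ (i - 1)`; the value at `i = 0` is `0`. -/
def gapTerm (ρ : ℝ) (i : ℕ) : ℝ := ρ * i * (1 - ρ * (1 - ρ)) ^ (i - 1)

/-- `ε_n`, the sum of `RHS(ρ, i)` over all `i ≥ n`. -/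
def gapSum (ρ : ℝ) (n : ℕ) : ℝ := ∑' k : ℕ, gapTerm ρ (n + k)

/-- The closed form that bounds `ε_n`. -/
def gapBound (ρ : ℝ) (n : ℕ) : ℝ :=
  (1 - ρ * (1 - ρ)) ^ n / (ρ * (1 - ρ) ^ 2) + n * (1 - ρ * (1 - ρ)) ^ (n - 1) / (1 - ρ)

end

/-!
The DAG `G_{n+1}` arises from `G_n` by adding a sink, so everything rests on how the `I`-Markov
equivalence class reacts to a new sink `v`.

Only two easy parts of the theory of Markov equivalence are needed, and both are proved directly
from conditional independence.

* *Hereditary properties.* Markov equivalence passes to induced subgraphs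
  (`DAG.MarkovEquiv.comap`), since a distribution on the subgraph can be extended by constant
  variables. It is preserved if the same sink is added to both DAGs (`DAG.MarkovEquiv.addSink`).
  Both use that the Markov property can be checked along a topological order
  (`DAG.famMarkov_of_isTopologicalOrder`), which follows from the contraction and weak union rules.
* *Skeleton and v-structures.* Markov equivalent DAGs have the same skeleton and the same
  v-structures (`DAG.MarkovEquiv.adj_or_adj`, `DAG.MarkovEquiv.adj_of_vStructure`): a shared fair
  coin detects an edge, and two independent coins together with their sum modulo two detect a
  v-structure. The converse, that skeleton and v-structures determine the Markov equivalence class,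
  is not used.

By the first part, members of the class of `G_n` extend to members of the class of `G_{n+1}`, and
members of the class of `G_{n+1}` restrict to members of the class of `G_n`. Hence old edges do not
change their status, and all metrics are monotone in `n`. By the second part, an edge `u → v` into
the new sink can only be unoriented if it is in no v-structure with `v`, that is, if `u` is a
*shielded parent* (`DAG.shieldedParents`). So the metrics grow by at most the number of shielded
parents, and if there are none, restriction is a bijection of the classes and nothing changes at
all. For each of the `n` possible `u` the probability to be a shielded parent is
`ρ (1 - ρ (1 - ρ)) ^ (n - 1)`, because each other vertex `w` independently fails to form a
v-structure `u → v ← w` with probability `1 - ρ (1 - ρ)`. The expected increments are therefore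
bounded by `gapTerm ρ n` (`IsEdgeArray.integral_ncard_shieldedParents`), which is summable, and
almost surely only finitely many of the new sinks have a shielded parent. This gives the limits, the
bounds and the eventual constancy of the class sizes; the class sizes are compared with the
numbers of unoriented edges by `DAG.classSize_le_two_pow`.

Finally, all metrics are invariant under relabelling, so that their expectations under the coupling
are those for random order DAGs (`IsEdgeArray.orderDAGExp_eq`).
-/

noncomputable section

/-! ### Conditional independence of σ-algebras -/

namespace ProbabilityTheory

section CondIndepAux

variable {Ω : Type*} {m₁ m₂ m₃ m' n' : MeasurableSpace Ω} {mΩ : MeasurableSpace Ω}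
  {μ : Measure Ω}

lemma sup_eq_generateFrom_inter (m₁ m₂ : MeasurableSpace Ω) :
    m₁ ⊔ m₂ = MeasurableSpace.generateFrom
      {s | ∃ a b, MeasurableSet[m₁] a ∧ MeasurableSet[m₂] b ∧ a ∩ b = s} := by
  apply le_antisymm
  · refine sup_le (fun s hs => ?_) (fun s hs => ?_)
    · exact MeasurableSpace.measurableSet_generateFrom
        ⟨s, Set.univ, hs, MeasurableSet.univ, Set.inter_univ s⟩
    · exact MeasurableSpace.measurableSet_generateFrom
        ⟨Set.univ, s, MeasurableSet.univ, hs, Set.univ_inter s⟩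
  · refine MeasurableSpace.generateFrom_le ?_
    rintro _ ⟨a, b, ha, hb, rfl⟩
    exact MeasurableSet.inter ((le_sup_left : m₁ ≤ m₁ ⊔ m₂) a ha)
      ((le_sup_right : m₂ ≤ m₁ ⊔ m₂) b hb)

lemma isPiSystem_measurableSet_inter (m₁ m₂ : MeasurableSpace Ω) :
    IsPiSystem {s | ∃ a b, MeasurableSet[m₁] a ∧ MeasurableSet[m₂] b ∧ a ∩ b = s} := by
  rintro _ ⟨a, b, ha, hb, rfl⟩ _ ⟨c, d, hc, hd, rfl⟩ -
  exact ⟨a ∩ c, b ∩ d, ha.inter hc, hb.inter hd, by ac_rfl⟩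

/-- Two integrable functions that have the same integral over the sets `a ∩ b` with `a` in `m₁` and
`b` in `m₂` have the same integral over every set of `m₁ ⊔ m₂`. -/
lemma setIntegral_eq_of_forall_inter {f g : Ω → ℝ} (h₁ : m₁ ≤ mΩ) (h₂ : m₂ ≤ mΩ)
    (hf : Integrable f μ) (hg : Integrable g μ)
    (h : ∀ a b, MeasurableSet[m₁] a → MeasurableSet[m₂] b →
      ∫ x in a ∩ b, f x ∂μ = ∫ x in a ∩ b, g x ∂μ)
    {s : Set Ω} (hs : MeasurableSet[m₁ ⊔ m₂] s) : ∫ x in s, f x ∂μ = ∫ x in s, g x ∂μ := by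
  have hle : m₁ ⊔ m₂ ≤ mΩ := sup_le h₁ h₂
  refine MeasurableSpace.induction_on_inter (m := m₁ ⊔ m₂)
    (C := fun s _ => ∫ x in s, f x ∂μ = ∫ x in s, g x ∂μ) (sup_eq_generateFrom_inter m₁ m₂)
    (isPiSystem_measurableSet_inter m₁ m₂) (by simp) ?_ ?_ ?_ s hs
  · rintro _ ⟨a, b, ha, hb, rfl⟩
    exact h a b ha hb
  · intro t ht iht
    have huniv := h Set.univ Set.univ MeasurableSet.univ MeasurableSet.univ
    rw [Set.inter_univ, setIntegral_univ, setIntegral_univ] at huniv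
    have e1 := integral_add_compl (hle t ht) hf
    have e2 := integral_add_compl (hle t ht) hg
    linarith
  · intro t hd ht iht
    rw [integral_iUnion (fun i => hle _ (ht i)) hd hf.integrableOn,
      integral_iUnion (fun i => hle _ (ht i)) hd hg.integrableOn]
    exact tsum_congr iht

variable [StandardBorelSpace Ω] [IsFiniteMeasure μ]

/-- Doob's characterization of conditional independence: additional knowledge of `m₂` does not
change the conditional probabilities of the events in `m₁` given `m'`. -/
lemma condIndep_iff_condExp_sup (hm' : m' ≤ mΩ) (h₁ : m₁ ≤ mΩ) (h₂ : m₂ ≤ mΩ) :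
    CondIndep m' m₁ m₂ hm' μ ↔
      ∀ t, MeasurableSet[m₁] t → μ⟦t | m' ⊔ m₂⟧ =ᵐ[μ] μ⟦t | m'⟧ := by
  have hle : m' ⊔ m₂ ≤ mΩ := sup_le hm' h₂
  have hint : ∀ t, MeasurableSet[mΩ] t → Integrable (t.indicator fun _ => (1 : ℝ)) μ :=
    fun t ht => (integrable_const 1).indicator ht
  have hmul : ∀ (f : Ω → ℝ) (t : Set Ω),
      f * (t.indicator fun _ => (1 : ℝ)) = t.indicator f := by
    intro f t
    ext x
    by_cases hx : x ∈ t <;> simp [hx]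
  -- the conditional probability of `t₁` given `m'` can be pulled out
  have hpull : ∀ t₁ t₂, MeasurableSet[mΩ] t₂ →
      μ[t₂.indicator (μ⟦t₁ | m'⟧) | m'] =ᵐ[μ] μ⟦t₁ | m'⟧ * μ⟦t₂ | m'⟧ := by
    intro t₁ t₂ ht₂
    have := condExp_mul_of_stronglyMeasurable_left (μ := μ) (m := m')
      (f := μ⟦t₁ | m'⟧) (g := t₂.indicator fun _ => (1 : ℝ)) stronglyMeasurable_condExp
      (by rw [hmul]; exact integrable_condExp.indicator ht₂) (hint _ ht₂)
    rwa [hmul] at this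
  rw [condIndep_iff _ _ _ hm' h₁ h₂]
  constructor
  · intro h t ht
    symm
    refine ae_eq_condExp_of_forall_setIntegral_eq hle (hint t (h₁ t ht))
      (fun s _ _ => integrable_condExp.integrableOn) ?_
      ((stronglyMeasurable_condExp.mono (le_sup_left : m' ≤ m' ⊔ m₂)).aestronglyMeasurable)
    intro s hs _
    refine setIntegral_eq_of_forall_inter hm' h₂ integrable_condExp (hint t (h₁ t ht)) ?_ hs
    intro a b ha hb
    have hb' := h₂ b hb
    have ha' := hm' a ha
    calc ∫ x in a ∩ b, (μ⟦t | m'⟧) x ∂μ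
        = ∫ x in a, b.indicator (μ⟦t | m'⟧) x ∂μ := by
          rw [setIntegral_indicator hb']
      _ = ∫ x in a, (μ[b.indicator (μ⟦t | m'⟧) | m']) x ∂μ :=
          (setIntegral_condExp hm' (integrable_condExp.indicator hb') ha).symm
      _ = ∫ x in a, (μ⟦t ∩ b | m'⟧) x ∂μ := by
          refine setIntegral_congr_ae ha' ?_
          filter_upwards [hpull t b hb', h t b ht hb] with x hx hx' _
          rw [hx, hx']
      _ = ∫ x in a, (t ∩ b).indicator (fun _ => (1 : ℝ)) x ∂μ :=
          setIntegral_condExp hm' (hint _ ((h₁ t ht).inter hb')) ha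
      _ = ∫ x in a ∩ b, t.indicator (fun _ => (1 : ℝ)) x ∂μ := by
          rw [← setIntegral_indicator hb', Set.indicator_indicator, Set.inter_comm]
  · intro h t₁ t₂ ht₁ ht₂
    have ht₂' := h₂ t₂ ht₂
    have e1 : μ⟦t₁ ∩ t₂ | m' ⊔ m₂⟧ =ᵐ[μ] t₂.indicator (μ⟦t₁ | m'⟧) := by
      have := condExp_indicator (μ := μ) (m := m' ⊔ m₂) (hint _ (h₁ t₁ ht₁))
        ((le_sup_right : m₂ ≤ m' ⊔ m₂) t₂ ht₂)
      rw [Set.indicator_indicator, Set.inter_comm] at this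
      filter_upwards [this, h t₁ ht₁] with x hx hx'
      rw [hx]
      by_cases hxt : x ∈ t₂ <;> simp [hxt, hx']
    calc μ⟦t₁ ∩ t₂ | m'⟧
        =ᵐ[μ] μ[μ⟦t₁ ∩ t₂ | m' ⊔ m₂⟧ | m'] :=
          (condExp_condExp_of_le le_sup_left hle).symm
      _ =ᵐ[μ] μ[t₂.indicator (μ⟦t₁ | m'⟧) | m'] := condExp_congr_ae e1
      _ =ᵐ[μ] μ⟦t₁ | m'⟧ * μ⟦t₂ | m'⟧ := hpull t₁ t₂ ht₂'

lemma CondIndep.congr_cond {hm' : m' ≤ mΩ} (h : CondIndep m' m₁ m₂ hm' μ)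
    (e : m' = n') (hn' : n' ≤ mΩ) : CondIndep n' m₁ m₂ hn' μ := by
  subst e
  exact h

/-- The contraction rule. -/
lemma CondIndep.contraction {hm' : m' ≤ mΩ} (h₁ : m₁ ≤ mΩ) (h₂ : m₂ ≤ mΩ) (h₃ : m₃ ≤ mΩ)
    (h : CondIndep m' m₁ m₂ hm' μ) (h' : CondIndep (m' ⊔ m₂) m₁ m₃ (sup_le hm' h₂) μ) :
    CondIndep m' m₁ (m₂ ⊔ m₃) hm' μ := by
  rw [condIndep_iff_condExp_sup _ h₁ (sup_le h₂ h₃)]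
  rw [condIndep_iff_condExp_sup _ h₁ h₂] at h
  rw [condIndep_iff_condExp_sup _ h₁ h₃] at h'
  intro t ht
  rw [← sup_assoc]
  exact (h' t ht).trans (h t ht)

/-- The weak union rule. -/
lemma CondIndep.weak_union {hm' : m' ≤ mΩ} (h₁ : m₁ ≤ mΩ) (h₂ : m₂ ≤ mΩ) (h₃₂ : m₃ ≤ m₂)
    (h : CondIndep m' m₁ m₂ hm' μ) :
    CondIndep (m' ⊔ m₃) m₁ m₂ (sup_le hm' (h₃₂.trans h₂)) μ := by
  have h3 := condIndep_of_condIndep_of_le_right h h₃₂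
  rw [condIndep_iff_condExp_sup _ h₁ h₂] at h ⊢
  rw [condIndep_iff_condExp_sup _ h₁ (h₃₂.trans h₂)] at h3
  intro t ht
  rw [sup_assoc, sup_eq_right.2 h₃₂]
  exact (h t ht).trans (h3 t ht).symm

/-- Events that are measurable with respect to the condition are conditionally independent of
everything. -/
lemma condIndep_of_le_cond (hm' : m' ≤ mΩ) (h₂ : m₂ ≤ mΩ) (h : m₁ ≤ m') :
    CondIndep m' m₁ m₂ hm' μ := by
  rw [condIndep_iff_condExp_sup _ (h.trans hm') h₂]
  intro t ht
  have hi : Integrable (t.indicator fun _ => (1 : ℝ)) μ :=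
    (integrable_const 1).indicator (hm' t (h t ht))
  rw [condExp_of_stronglyMeasurable hm' (stronglyMeasurable_const.indicator (h t ht)) hi,
    condExp_of_stronglyMeasurable (sup_le hm' h₂)
      (stronglyMeasurable_const.indicator ((h.trans le_sup_left) t ht)) hi]

end CondIndepAux

section Map

variable {Ω Ω' : Type*} {m' m₁ m₂ : MeasurableSpace Ω'} {mΩ : MeasurableSpace Ω}
  {mΩ' : MeasurableSpace Ω'} {μ : Measure Ω}
  [IsFiniteMeasure μ] {T : Ω → Ω'}

lemma condExp_map_comp (hT : Measurable T) (hm' : m' ≤ mΩ') {f : Ω' → ℝ}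
    (hf : Integrable f (μ.map T)) :
    (fun x => ((μ.map T)[f | m']) (T x)) =ᵐ[μ] μ[fun x => f (T x) | m'.comap T] := by
  have hle : m'.comap T ≤ mΩ := (MeasurableSpace.comap_mono hm').trans hT.comap_le
  refine ae_eq_condExp_of_forall_setIntegral_eq hle (hf.comp_measurable hT)
    (fun s _ _ => (integrable_condExp.comp_measurable hT).integrableOn) ?_ ?_
  · rintro _ ⟨s, hs, rfl⟩ _
    rw [← setIntegral_map (hm' s hs) (integrable_condExp).aestronglyMeasurable hT.aemeasurable,
      ← setIntegral_map (hm' s hs) hf.aestronglyMeasurable hT.aemeasurable]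
    exact setIntegral_condExp hm' hf hs
  · exact (stronglyMeasurable_condExp.comp_measurable
      (comap_measurable T)).aestronglyMeasurable

/-- Conditional independence under an image measure is conditional independence of the pulled back
σ-algebras. -/
lemma condIndep_map_iff [StandardBorelSpace Ω] [StandardBorelSpace Ω'] (hT : Measurable T)
    (hm' : m' ≤ mΩ') (h₁ : m₁ ≤ mΩ') (h₂ : m₂ ≤ mΩ') :
    CondIndep m' m₁ m₂ hm' (μ.map T) ↔
      CondIndep (m'.comap T) (m₁.comap T) (m₂.comap T)
        ((MeasurableSpace.comap_mono hm').trans hT.comap_le) μ := by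
  have hc : ∀ {m : MeasurableSpace Ω'}, m ≤ mΩ' → m.comap T ≤ mΩ := fun h =>
    (MeasurableSpace.comap_mono h).trans hT.comap_le
  rw [condIndep_iff_condExp_sup _ h₁ h₂, condIndep_iff_condExp_sup _ (hc h₁) (hc h₂)]
  have hstep : ∀ t, MeasurableSet[m₁] t →
      ((μ.map T)⟦t | m' ⊔ m₂⟧ =ᵐ[μ.map T] (μ.map T)⟦t | m'⟧ ↔
        μ⟦T ⁻¹' t | m'.comap T ⊔ m₂.comap T⟧ =ᵐ[μ] μ⟦T ⁻¹' t | m'.comap T⟧) := by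
    intro t ht
    rw [← MeasurableSpace.comap_sup]
    have hi : Integrable (t.indicator fun _ => (1 : ℝ)) (μ.map T) :=
      (integrable_const (1 : ℝ)).indicator (h₁ t ht)
    have e1 : _ =ᵐ[μ] μ⟦T ⁻¹' t | (m' ⊔ m₂).comap T⟧ := condExp_map_comp hT (sup_le hm' h₂) hi
    have e2 : _ =ᵐ[μ] μ⟦T ⁻¹' t | m'.comap T⟧ := condExp_map_comp hT hm' hi
    have hae : ((μ.map T)⟦t | m' ⊔ m₂⟧ =ᵐ[μ.map T] (μ.map T)⟦t | m'⟧) ↔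
        ∀ᵐ x ∂μ, ((μ.map T)⟦t | m' ⊔ m₂⟧) (T x) = ((μ.map T)⟦t | m'⟧) (T x) :=
      ae_map_iff hT.aemeasurable (measurableSet_eq_fun
        (stronglyMeasurable_condExp.mono (sup_le hm' h₂)).measurable
        (stronglyMeasurable_condExp.mono hm').measurable)
    rw [hae]
    constructor
    · intro h
      filter_upwards [h, e1, e2] with x hx h1 h2
      rw [← h1, ← h2, hx]
    · intro h
      filter_upwards [h, e1, e2] with x hx h1 h2
      rw [h1, h2, hx]
  constructor
  · rintro h _ ⟨t, ht, rfl⟩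
    exact (hstep t ht).1 (h t ht)
  · intro h t ht
    exact (hstep t ht).2 (h _ ⟨t, ht, rfl⟩)

end Map

end ProbabilityTheory

/-! ### The Markov property of a family of σ-algebras -/

namespace DAG

variable {V : Type*}

@[ext]
lemma ext_adj {G H : DAG V} (h : ∀ a b, G.Adj a b ↔ H.Adj a b) : G = H := by
  obtain ⟨⟨a⟩, _⟩ := G
  obtain ⟨⟨b⟩, _⟩ := H
  have : a = b := by
    ext x y
    exact h x y
  subst this
  rfl

lemma not_adj_self (G : DAG V) (v : V) : ¬ G.Adj v v := fun h =>
  G.acyclic v (Relation.TransGen.single h)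

lemma not_adj_symm (G : DAG V) {a b : V} (h : G.Adj a b) : ¬ G.Adj b a := fun h' =>
  G.acyclic a ((Relation.TransGen.single h).tail h')

lemma mem_parents {G : DAG V} {v w : V} : w ∈ G.parents v ↔ G.Adj w v := Iff.rfl

lemma parents_subset_nonDescendants (G : DAG V) (v : V) :
    G.parents v ⊆ G.nonDescendants v := fun w hw h =>
  G.acyclic w (Relation.TransGen.head' hw h)

/-- A topological order of `G`, given by distinct natural positions of the vertices. -/
def IsTopologicalOrder (G : DAG V) (f : V → ℕ) : Prop :=
  Function.Injective f ∧ ∀ a b, G.Adj a b → f a < f b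

lemma exists_isTopologicalOrder [Finite V] (G : DAG V) : ∃ f, G.IsTopologicalOrder f := by
  classical
  have hpo : IsPartialOrder V (Relation.ReflTransGen G.Adj) :=
    { refl := fun _ => Relation.ReflTransGen.refl
      trans := fun _ _ _ => Relation.ReflTransGen.trans
      antisymm := by
        intro a b hab hba
        rcases Relation.reflTransGen_iff_eq_or_transGen.1 hab with h | h
        · exact h.symm
        · exact absurd (h.trans_left hba) (G.acyclic a) }
  obtain ⟨s, hs, hle⟩ := extend_partialOrder (Relation.ReflTransGen G.Adj)
  have hmono : ∀ a b, a ≠ b → s a b → {w | s w a}.ncard < {w | s w b}.ncard := by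
    intro a b hne hab
    refine Set.ncard_lt_ncard ⟨fun w hw => hs.trans _ _ _ hw hab, fun h => hne ?_⟩
      (Set.toFinite _)
    exact hs.antisymm _ _ hab (h (hs.refl b))
  refine ⟨fun v => {w | s w v}.ncard, fun a b hab => ?_, fun a b hab => hmono a b ?_ ?_⟩
  · by_contra hne
    rcases hs.total a b with h | h
    · exact (hmono a b hne h).ne hab
    · exact (hmono b a (Ne.symm hne) h).ne hab.symm
  · rintro rfl
    exact G.not_adj_self a hab
  · exact hle a b (Relation.ReflTransGen.single hab)

lemma IsTopologicalOrder.le_of_reflTransGen {G : DAG V} {f : V → ℕ} (hf : G.IsTopologicalOrder f)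
    {a b : V} (h : Relation.ReflTransGen G.Adj a b) : f a ≤ f b := by
  induction h with
  | refl => exact le_rfl
  | tail _ h ih => exact ih.trans (hf.2 _ _ h).le

lemma IsTopologicalOrder.mem_nonDescendants {G : DAG V} {f : V → ℕ} (hf : G.IsTopologicalOrder f)
    {a b : V} (h : f b < f a) : b ∈ G.nonDescendants a := fun h' =>
  (hf.le_of_reflTransGen h').not_gt h

variable {Ω : Type*} {mΩ : MeasurableSpace Ω} [StandardBorelSpace Ω]

/-- The Markov property with respect to `G` of a family of σ-algebras `𝓕 v`, the information
carried by the vertices `v`. Working with σ-algebras makes the law of the variables a matter of the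
choice of `Ω`, and lets a deterministic variable be represented by the trivial σ-algebra. -/
def FamMarkov (G : DAG V) (μ : Measure Ω) [IsFiniteMeasure μ] (𝓕 : V → MeasurableSpace Ω)
    (h𝓕 : ∀ v, 𝓕 v ≤ mΩ) : Prop :=
  ∀ v, CondIndep (⨆ w ∈ G.parents v, 𝓕 w) (𝓕 v) (⨆ w ∈ G.nonDescendants v, 𝓕 w)
    (iSup₂_le fun w _ => h𝓕 w) μ

variable {μ : Measure Ω} [IsFiniteMeasure μ] {𝓕 : V → MeasurableSpace Ω} {h𝓕 : ∀ v, 𝓕 v ≤ mΩ}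

/-- It suffices to check the Markov property along a topological order: each vertex has to be
conditionally independent of its predecessors in the order, given its parents. The non-descendants
that come later in the order are added one at a time, by contraction. -/
lemma famMarkov_of_isTopologicalOrder {G : DAG V} {f : V → ℕ} (hf : G.IsTopologicalOrder f)
    [Finite V]
    (h : ∀ v, CondIndep (⨆ w ∈ G.parents v, 𝓕 w) (𝓕 v) (⨆ w ∈ {w | f w < f v}, 𝓕 w)
      (iSup₂_le fun w _ => h𝓕 w) μ) : G.FamMarkov μ 𝓕 h𝓕 := by
  intro u
  have hsup : ∀ S : Set V, ⨆ w ∈ S, 𝓕 w ≤ mΩ := fun S => iSup₂_le fun w _ => h𝓕 w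
  have hmono : ∀ {S T : Set V}, S ⊆ T → ⨆ w ∈ S, 𝓕 w ≤ ⨆ w ∈ T, 𝓕 w := fun hST =>
    biSup_mono hST
  have hpar : ∀ v, G.parents v ⊆ {w | f w < f v} := fun v w hw => hf.2 w v hw
  have key : ∀ k, CondIndep (⨆ w ∈ G.parents u, 𝓕 w) (𝓕 u)
      (⨆ w ∈ {w | w ∈ G.nonDescendants u ∧ f w < f u + k}, 𝓕 w) (hsup _) μ := by
    intro k
    induction k with
    | zero => exact condIndep_of_condIndep_of_le_right (h u) (hmono fun w hw => hw.2)
    | succ k ih =>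
      by_cases hex : ∃ w ∈ G.nonDescendants u, f w = f u + k
      · obtain ⟨w, hw, hfw⟩ := hex
        set N : Set V := {w | w ∈ G.nonDescendants u ∧ f w < f u + k} with hN
        have hk : 0 < k := by
          rcases Nat.eq_zero_or_pos k with h0 | h0
          · have : w = u := hf.1 (by omega)
            exact absurd (this ▸ Relation.ReflTransGen.refl) hw
          · exact h0
        have hparN : G.parents w ⊆ N := by
          intro x hx
          refine ⟨fun hux => hw (hux.tail hx), ?_⟩
          have := hf.2 x w hx
          omega
        have hNw : N ⊆ {x | f x < f w} := fun x hx => by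
          have := hx.2
          change f x < f w
          omega
        have hpuN : G.parents u ⊆ N := fun x hx =>
          ⟨G.parents_subset_nonDescendants u hx, by have := hf.2 x u hx; omega⟩
        have h1 := (h w).weak_union (h𝓕 w) (hsup _) (hmono hNw)
        have h2 := h1.congr_cond (sup_eq_right.2 (hmono hparN)) (hsup N)
        have hu : 𝓕 u ≤ ⨆ x ∈ {x | f x < f w}, 𝓕 x :=
          le_biSup 𝓕 (show f u < f w by omega)
        have h3 := (condIndep_of_condIndep_of_le_right h2 hu).symm
        have h4 := ih.contraction (h𝓕 u) (hsup N) (h𝓕 w)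
          (h3.congr_cond (sup_eq_right.2 (hmono hpuN)).symm _)
        refine condIndep_of_condIndep_of_le_right h4 (iSup₂_le fun x hx => ?_)
        rcases Nat.lt_or_ge (f x) (f u + k) with hlt | hge
        · exact (le_biSup 𝓕 (show x ∈ N from ⟨hx.1, hlt⟩)).trans le_sup_left
        · have : x = w := hf.1 (by have := hx.2; omega)
          exact this ▸ le_sup_right
      · refine condIndep_of_condIndep_of_le_right ih (hmono fun x hx => ⟨hx.1, ?_⟩)
        have h1 := hx.2
        have h2 : f x ≠ f u + k := fun hc => hex ⟨x, hx.1, hc⟩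
        omega
  obtain ⟨K, hK⟩ : ∃ K, ∀ w, f w < K := by
    obtain ⟨K, hK⟩ := (Set.finite_range f).bddAbove
    exact ⟨K + 1, fun w => Nat.lt_succ_of_le (hK ⟨w, rfl⟩)⟩
  exact condIndep_of_condIndep_of_le_right (key K)
    (hmono fun w hw => ⟨hw, (hK w).trans_le (Nat.le_add_left _ _)⟩)

/-- In a topological order, each vertex is conditionally independent of its predecessors. -/
lemma FamMarkov.condIndep_predecessors {G : DAG V} (h : G.FamMarkov μ 𝓕 h𝓕) {f : V → ℕ}
    (hf : G.IsTopologicalOrder f) (v : V) :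
    CondIndep (⨆ w ∈ G.parents v, 𝓕 w) (𝓕 v) (⨆ w ∈ {w | f w < f v}, 𝓕 w)
      (iSup₂_le fun w _ => h𝓕 w) μ :=
  condIndep_of_condIndep_of_le_right (h v)
    (biSup_mono fun _ hw => hf.mem_nonDescendants hw)

/-- The σ-algebra of the coordinates in `S` is generated by these coordinates. -/
lemma comap_proj_eq_iSup {Ω : Type*} (T : Ω → V → ℝ) (S : Set V) :
    (MeasurableSpace.comap (proj S) inferInstance).comap T =
      ⨆ w ∈ S, MeasurableSpace.comap (fun ω => T ω w) inferInstance := by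
  rw [MeasurableSpace.comap_comp, iSup_subtype', MeasurableSpace.pi, MeasurableSpace.comap_iSup]
  refine iSup_congr fun w => ?_
  rw [MeasurableSpace.comap_comp]
  rfl

/-- The law of the random variables `T · v` is Markov if and only if the σ-algebras that they
generate are. -/
lemma isMarkov_map_iff [Finite V] (G : DAG V) (T : Ω → V → ℝ) (hT : Measurable T)
    [IsProbabilityMeasure (μ.map T)] :
    G.IsMarkov (μ.map T) ↔
      G.FamMarkov μ (fun v => MeasurableSpace.comap (fun ω => T ω v) inferInstance)
        (fun v => ((measurable_pi_apply v).comp hT).comap_le) := by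
  refine forall_congr' fun v => ?_
  rw [condIndepFun_iff_condIndep, condIndep_map_iff hT (measurable_proj _).comap_le
    (measurable_pi_apply v).comap_le (measurable_proj _).comap_le]
  have e1 := comap_proj_eq_iSup T (G.parents v)
  have e2 := comap_proj_eq_iSup T (G.nonDescendants v)
  have e3 : (MeasurableSpace.comap (fun x : V → ℝ => x v) inferInstance).comap T =
      MeasurableSpace.comap (fun ω => T ω v) inferInstance := MeasurableSpace.comap_comp
  rw [e2, e3]
  exact ⟨fun h => h.congr_cond e1 _, fun h => h.congr_cond e1.symm _⟩

/-- A distribution that is Markov with respect to `G` is Markov with respect to every Markov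
equivalent DAG, on any probability space. -/
lemma MarkovEquiv.famMarkov [Finite V] {G H : DAG V} (h : MarkovEquiv G H)
    [IsProbabilityMeasure μ] {T : Ω → V → ℝ} (hT : Measurable T)
    (hG : G.FamMarkov μ (fun v => MeasurableSpace.comap (fun ω => T ω v) inferInstance)
        (fun v => ((measurable_pi_apply v).comp hT).comap_le)) :
    H.FamMarkov μ (fun v => MeasurableSpace.comap (fun ω => T ω v) inferInstance)
        (fun v => ((measurable_pi_apply v).comp hT).comap_le) := by
  have : IsProbabilityMeasure (μ.map T) := Measure.isProbabilityMeasure_map hT.aemeasurable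
  exact (H.isMarkov_map_iff T hT).1 ((h _).1 ((G.isMarkov_map_iff T hT).2 hG))

lemma isMarkov_iff_famMarkov [Finite V] (G : DAG V) (P : Measure (V → ℝ)) [IsProbabilityMeasure P] :
    G.IsMarkov P ↔ G.FamMarkov P
      (fun v => MeasurableSpace.comap (fun x : V → ℝ => x v) inferInstance)
      (fun v => (measurable_pi_apply v).comap_le) := by
  have : IsProbabilityMeasure (P.map id) := by rwa [Measure.map_id]
  have h := G.isMarkov_map_iff (μ := P) id measurable_id
  simp only [Measure.map_id] at h
  exact h

lemma MarkovEquiv.symm [Finite V] {G H : DAG V} (h : MarkovEquiv G H) : MarkovEquiv H G :=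
  fun P _ => (h P).symm

lemma MarkovEquiv.refl [Finite V] (G : DAG V) : MarkovEquiv G G := fun _ _ => Iff.rfl

end DAG

namespace DAG

/-! ### Induced subgraphs and Markov equivalence -/

section Comap

variable {V W : Type*}

/-- The DAG induced on `W` by a map `e : W → V`. For an injective `e` this is an induced subgraph of
`G`, and for a bijective `e` a relabelling of `G`. -/
def comap (G : DAG V) (e : W → V) : DAG W where
  Adj a b := G.Adj (e a) (e b)
  acyclic v h := G.acyclic (e v) (Relation.TransGen.lift e (fun _ _ h => h) _ _ h)

@[simp]
lemma comap_adj (G : DAG V) (e : W → V) (a b : W) : (G.comap e).Adj a b ↔ G.Adj (e a) (e b) :=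
  Iff.rfl

lemma reflTransGen_of_comap {G : DAG V} {e : W → V} {a b : W}
    (h : Relation.ReflTransGen (G.comap e).Adj a b) : Relation.ReflTransGen G.Adj (e a) (e b) :=
  Relation.ReflTransGen.lift e (fun _ _ h => h) _ _ h

lemma IsTopologicalOrder.comap {G : DAG V} {f : V → ℕ} (hf : G.IsTopologicalOrder f) {e : W → V}
    (he : Function.Injective e) : (G.comap e).IsTopologicalOrder (f ∘ e) :=
  ⟨hf.1.comp he, fun _ _ h => hf.2 _ _ h⟩

lemma biSup_eq_biSup_preimage {Ω : Type*} {𝓕 : V → MeasurableSpace Ω} {e : W → V}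
    {S : Set V} (h : ∀ v ∈ S, v ∉ Set.range e → 𝓕 v = ⊥) :
    ⨆ w ∈ S, 𝓕 w = ⨆ w ∈ e ⁻¹' S, 𝓕 (e w) := by
  apply le_antisymm
  · refine iSup₂_le fun w hw => ?_
    by_cases hr : w ∈ Set.range e
    · obtain ⟨w', rfl⟩ := hr
      exact le_biSup (fun w => 𝓕 (e w)) (show w' ∈ e ⁻¹' S from hw)
    · rw [h w hw hr]
      exact bot_le
  · exact iSup₂_le fun w hw => le_biSup 𝓕 (show e w ∈ S from hw)

variable {Ω : Type*} {mΩ : MeasurableSpace Ω} [StandardBorelSpace Ω] {μ : Measure Ω}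
  [IsFiniteMeasure μ] {𝓕 : V → MeasurableSpace Ω} {h𝓕 : ∀ v, 𝓕 v ≤ mΩ} {e : W → V}

lemma FamMarkov.congr_fam {G : DAG V} {𝓖 : V → MeasurableSpace Ω} (h : G.FamMarkov μ 𝓕 h𝓕)
    (e : 𝓕 = 𝓖) (h𝓖 : ∀ v, 𝓖 v ≤ mΩ) : G.FamMarkov μ 𝓖 h𝓖 := by
  subst e
  exact h

/-- Vertices without information may be added: there are fewer non-descendants in `G` than in the
subgraph, as paths through the new vertices only create descendants. -/
lemma famMarkov_of_comap {G : DAG V} (hbot : ∀ v ∉ Set.range e, 𝓕 v = ⊥)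
    (h : (G.comap e).FamMarkov μ (fun w => 𝓕 (e w)) (fun w => h𝓕 (e w))) :
    G.FamMarkov μ 𝓕 h𝓕 := by
  intro v
  by_cases hv : v ∈ Set.range e
  · obtain ⟨u, rfl⟩ := hv
    refine ((condIndep_of_condIndep_of_le_right (h u) ?_).congr_cond
      (biSup_eq_biSup_preimage (S := G.parents (e u)) fun v _ => hbot v).symm _)
    rw [biSup_eq_biSup_preimage (e := e) fun v _ => hbot v]
    exact biSup_mono fun w hw h => hw (reflTransGen_of_comap h)
  · have h0 : 𝓕 v = ⊥ := hbot v hv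
    have := condIndep_bot_left (μ := μ) (hm' := (iSup₂_le fun w _ => h𝓕 w :
      ⨆ w ∈ G.parents v, 𝓕 w ≤ mΩ)) (⨆ w ∈ G.nonDescendants v, 𝓕 w)
    rwa [← h0] at this

/-- Vertices without information may be deleted. The subgraph can have more non-descendants than
`G`, but a topological order of `G` restricts to one of the subgraph. -/
lemma FamMarkov.comap_of_eq_bot [Finite V] [Finite W] (he : Function.Injective e) {G : DAG V}
    (hbot : ∀ v ∉ Set.range e, 𝓕 v = ⊥) (h : G.FamMarkov μ 𝓕 h𝓕) :
    (G.comap e).FamMarkov μ (fun w => 𝓕 (e w)) (fun w => h𝓕 (e w)) := by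
  obtain ⟨f, hf⟩ := G.exists_isTopologicalOrder
  refine famMarkov_of_isTopologicalOrder (hf.comap he) fun v => ?_
  have h1 := (h.condIndep_predecessors hf (e v)).congr_cond
    (biSup_eq_biSup_preimage (e := e) fun v _ => hbot v) (iSup₂_le fun w _ => h𝓕 (e w))
  rwa [biSup_eq_biSup_preimage (e := e) fun v _ => hbot v] at h1

/-- Markov equivalence passes to induced subgraphs: a distribution on the subgraph is extended by
constant variables. -/
lemma MarkovEquiv.comap [Finite V] [Finite W] {G H : DAG V} (h : MarkovEquiv G H) {e : W → V}
    (he : Function.Injective e) : MarkovEquiv (G.comap e) (H.comap e) := by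
  have key : ∀ (G H : DAG V), MarkovEquiv G H → ∀ (P : Measure (W → ℝ)) [IsProbabilityMeasure P],
      (G.comap e).IsMarkov P → (H.comap e).IsMarkov P := by
    intro G H h P _ hG
    set T : (W → ℝ) → V → ℝ := fun x => Function.extend e x 0 with hT
    have hrange : ∀ w, (fun x => T x (e w)) = fun x : W → ℝ => x w := fun w => by
      ext x
      exact he.extend_apply x 0 w
    have hout : ∀ v ∉ Set.range e, (fun x => T x v) = fun _ => 0 := fun v hv => by
      ext x
      exact Function.extend_apply' _ _ _ hv
    have hTm : Measurable T := by
      refine measurable_pi_lambda _ fun v => ?_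
      by_cases hv : v ∈ Set.range e
      · obtain ⟨w, rfl⟩ := hv
        rw [hrange]
        exact measurable_pi_apply w
      · rw [hout v hv]
        exact measurable_const
    have hbot : ∀ v ∉ Set.range e,
        MeasurableSpace.comap (fun x => T x v) inferInstance = ⊥ := fun v hv => by
      rw [hout v hv, MeasurableSpace.comap_const]
    have hfam : (fun w => MeasurableSpace.comap (fun x => T x (e w)) inferInstance) =
        fun w => MeasurableSpace.comap (fun x : W → ℝ => x w) inferInstance := by
      ext1 w
      rw [hrange]
    rw [isMarkov_iff_famMarkov] at hG ⊢
    exact ((h.famMarkov hTm (famMarkov_of_comap hbot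
      (hG.congr_fam hfam.symm _))).comap_of_eq_bot he hbot).congr_fam hfam _
  exact fun P _ => ⟨key G H h P, key H G h.symm P⟩

/-- Markov equivalence is preserved if the same sink `v` is added to both DAGs. -/
lemma MarkovEquiv.of_comap_sink [Finite V] [Finite W] {G H : DAG V} (he : Function.Injective e)
    {v : V} (hrange : Set.range e = {v}ᶜ) (hG : ∀ b, ¬ G.Adj v b) (hH : ∀ b, ¬ H.Adj v b)
    (hpar : G.parents v = H.parents v) (h : MarkovEquiv (G.comap e) (H.comap e)) :
    MarkovEquiv G H := by
  have hne : ∀ w, e w ≠ v := fun w => by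
    have : e w ∈ ({v}ᶜ : Set V) := hrange ▸ Set.mem_range_self w
    exact this
  have hex : ∀ u, u ≠ v → u ∈ Set.range e := fun u hu => by
    rw [hrange]
    exact hu
  have key : ∀ (G H : DAG V), (∀ b, ¬ G.Adj v b) → (∀ b, ¬ H.Adj v b) →
      G.parents v = H.parents v → MarkovEquiv (G.comap e) (H.comap e) →
      ∀ (P : Measure (V → ℝ)) [IsProbabilityMeasure P], G.IsMarkov P → H.IsMarkov P := by
    intro G H hG hH hpar h P _ hP
    rw [isMarkov_iff_famMarkov] at hP ⊢
    have hpa : ∀ (K : DAG V), (∀ b, ¬ K.Adj v b) → ∀ u,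
        ⨆ w ∈ K.parents u, MeasurableSpace.comap (fun x : V → ℝ => x w) inferInstance =
          ⨆ w ∈ e ⁻¹' K.parents u,
            MeasurableSpace.comap (fun x : V → ℝ => x (e w)) inferInstance := by
      intro K hK u
      refine biSup_eq_biSup_preimage fun w hw hw' => absurd ?_ (hK u)
      have : w = v := by
        by_contra hc
        exact hw' (hex w hc)
      exact this ▸ hw
    -- the marginal distribution is Markov with respect to the subgraph
    have hdesc : ∀ u b, Relation.ReflTransGen G.Adj (e u) b → ∀ w, e w = b →
        Relation.ReflTransGen (G.comap e).Adj u w := by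
      intro u b hb
      induction hb with
      | refl =>
        intro w hw
        rw [he hw]
      | @tail c d _ hcd ih =>
        rintro w rfl
        obtain ⟨c', rfl⟩ := hex c (fun hc => hG _ (hc ▸ hcd))
        exact (ih c' rfl).tail hcd
    have hmarg : (G.comap e).FamMarkov P
        (fun w => MeasurableSpace.comap (fun x : V → ℝ => x (e w)) inferInstance)
        (fun w => (measurable_pi_apply (e w)).comap_le) := by
      intro u
      refine (condIndep_of_condIndep_of_le_right (hP (e u)) ?_).congr_cond (hpa G hG (e u)) _
      exact iSup₂_le fun w hw => le_biSup
        (fun w => MeasurableSpace.comap (fun x : V → ℝ => x w) inferInstance)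
        (show e w ∈ G.nonDescendants (e u) from fun hc => hw (hdesc u _ hc w rfl))
    have hmargH := h.famMarkov (T := fun (x : V → ℝ) w => x (e w))
      (measurable_pi_lambda _ fun w => measurable_pi_apply (e w)) hmarg
    -- a topological order of `H` in which the sink `v` comes last
    classical
    obtain ⟨f, hf⟩ := H.exists_isTopologicalOrder
    obtain ⟨K, hK⟩ : ∃ K, ∀ w, f w < K := by
      obtain ⟨K, hK⟩ := (Set.finite_range f).bddAbove
      exact ⟨K + 1, fun w => Nat.lt_succ_of_le (hK ⟨w, rfl⟩)⟩
    set g : V → ℕ := fun w => if w = v then K else f w with hg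
    have hgv : g v = K := by simp [hg]
    have hgw : ∀ w, w ≠ v → g w = f w := fun w hw => by simp [hg, hw]
    have hgo : H.IsTopologicalOrder g := by
      constructor
      · intro a b hab
        by_cases ha : a = v <;> by_cases hb : b = v
        · rw [ha, hb]
        · rw [ha, hgv, hgw b hb] at hab
          exact absurd hab (hK b).ne'
        · rw [hb, hgv, hgw a ha] at hab
          exact absurd hab (hK a).ne
        · rw [hgw a ha, hgw b hb] at hab
          exact hf.1 hab
      · intro a b hab
        have ha : a ≠ v := fun hc => hH b (hc ▸ hab)
        by_cases hb : b = v
        · rw [hb, hgv, hgw a ha]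
          exact hK a
        · rw [hgw a ha, hgw b hb]
          exact hf.2 a b hab
    refine famMarkov_of_isTopologicalOrder hgo fun u => ?_
    by_cases hu : u = v
    · subst hu
      refine (condIndep_of_condIndep_of_le_right (hP u) ?_).congr_cond (by rw [hpar]) _
      refine biSup_mono fun w hw hc => ?_
      rcases Relation.ReflTransGen.cases_head hc with rfl | ⟨c, hc, _⟩
      · exact lt_irrefl (g u) hw
      · exact hG c hc
    · obtain ⟨u', rfl⟩ := hex u hu
      refine (condIndep_of_condIndep_of_le_right (hmargH u') ?_).congr_cond
        (hpa H hH (e u')).symm _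
      refine iSup₂_le fun w hw => ?_
      have hw' : g w < f (e u') := by
        rw [← hgw _ hu]
        exact hw
      have hwv : w ≠ v := by
        rintro rfl
        rw [hgv] at hw'
        exact lt_asymm hw' (hK _)
      obtain ⟨w', rfl⟩ := hex w hwv
      rw [hgw _ hwv] at hw'
      exact le_biSup (fun w => MeasurableSpace.comap (fun x : V → ℝ => x (e w)) inferInstance)
        ((hf.comap he).mem_nonDescendants hw')
  exact fun P _ => ⟨key G H hG hH hpar h P, key H G hH hG hpar.symm h.symm P⟩

end Comap

/-! ### Markov equivalent DAGs have the same skeleton and the same v-structures -/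

section Coins

/-- The law of two independent fair coins. -/
def twoCoins : Measure (Bool × Bool) :=
  ((PMF.uniformOfFintype Bool).toMeasure).prod (PMF.uniformOfFintype Bool).toMeasure

instance : IsProbabilityMeasure twoCoins := by
  unfold twoCoins
  infer_instance

/-- The σ-algebra of the real random variable that takes the value `1` where `φ` is true and `0`
elsewhere. -/
@[reducible]
def coinAlgebra {Ω : Type*} (φ : Ω → Bool) : MeasurableSpace Ω :=
  MeasurableSpace.comap (fun ω => if φ ω = true then (1 : ℝ) else 0) inferInstance

lemma coinAlgebra_le {Ω : Type*} {m : MeasurableSpace Ω} {φ : Ω → Bool}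
    (h : MeasurableSet[m] {ω | φ ω = true}) : coinAlgebra φ ≤ m :=
  (Measurable.ite h measurable_const measurable_const).comap_le

lemma measurableSet_coinAlgebra {Ω : Type*} (φ : Ω → Bool) :
    MeasurableSet[coinAlgebra φ] {ω | φ ω = true} := by
  refine ⟨{1}, measurableSet_singleton _, ?_⟩
  ext ω
  by_cases h : φ ω = true <;> simp [h]

lemma coinAlgebra_const {Ω : Type*} (b : Bool) : coinAlgebra (fun _ : Ω => b) = ⊥ :=
  MeasurableSpace.comap_const _

lemma coinAlgebra_le_top (φ : Bool × Bool → Bool) :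
    coinAlgebra φ ≤ (inferInstance : MeasurableSpace (Bool × Bool)) :=
  coinAlgebra_le (Set.toFinite _).measurableSet

lemma measurableSet_coinAlgebra_xor (m : MeasurableSpace (Bool × Bool)) {φ ψ : Bool × Bool → Bool}
    (hφ : coinAlgebra φ ≤ m) (hψ : coinAlgebra ψ ≤ m) :
    MeasurableSet[m] {ω | xor (φ ω) (ψ ω) = true} := by
  have h1 := hφ _ (measurableSet_coinAlgebra φ)
  have h2 := hψ _ (measurableSet_coinAlgebra ψ)
  convert (h1.diff h2).union (h2.diff h1) using 1
  ext ω
  simp only [Set.mem_ofPred_eq, Set.mem_union, Set.mem_sdiff]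
  cases φ ω <;> cases ψ ω <;> simp

lemma forall_of_ae_twoCoins {p : Bool × Bool → Prop} (h : ∀ᵐ ω ∂twoCoins, p ω) (ω : Bool × Bool) :
    p ω := by
  by_contra hc
  have h0 : twoCoins {ω} = 0 := measure_mono_null (by simpa using hc) h
  have : ({ω} : Set (Bool × Bool)) = {ω.1} ×ˢ {ω.2} := by
    ext x
    simp [Prod.ext_iff]
  rw [twoCoins, this, Measure.prod_prod] at h0
  simp at h0

lemma indep_fst_snd_twoCoins :
    Indep (coinAlgebra Prod.fst) (coinAlgebra Prod.snd) twoCoins := by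
  have h := indepFun_prod (μ := (PMF.uniformOfFintype Bool).toMeasure)
    (ν := (PMF.uniformOfFintype Bool).toMeasure)
    (X := fun b : Bool => if b = true then (1 : ℝ) else 0)
    (Y := fun b : Bool => if b = true then (1 : ℝ) else 0)
    (measurable_of_finite _) (measurable_of_finite _)
  exact h

lemma condIndep_bot_of_indep {Ω : Type*} {m₁ m₂ mΩ : MeasurableSpace Ω} [StandardBorelSpace Ω]
    {μ : Measure Ω} [IsProbabilityMeasure μ] (h₁ : m₁ ≤ mΩ) (h₂ : m₂ ≤ mΩ) (h : Indep m₁ m₂ μ) :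
    CondIndep ⊥ m₁ m₂ bot_le μ := by
  rw [condIndep_iff_condExp_sup _ h₁ h₂]
  intro t ht
  rw [bot_sup_eq, condExp_bot]
  exact condExp_indep_eq h₁ h₂ (stronglyMeasurable_const.indicator ht) h

/-- If no point is null and the condition does not separate two points, then an event that does
separate them is not conditionally independent of a σ-algebra that determines it together with the
condition. -/
lemma not_condIndep_of_not_separated {Ω : Type*} {m' m₁ m₂ mΩ : MeasurableSpace Ω}
    [StandardBorelSpace Ω] {μ : Measure Ω} [IsFiniteMeasure μ]
    (hμ : ∀ p : Ω → Prop, (∀ᵐ ω ∂μ, p ω) → ∀ ω, p ω) (hm' : m' ≤ mΩ) (h₁ : m₁ ≤ mΩ)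
    (h₂ : m₂ ≤ mΩ) {f : Ω → ℝ} (hle : m' ≤ MeasurableSpace.comap f inferInstance) {t : Set Ω}
    (ht₁ : MeasurableSet[m₁] t) (ht₂ : MeasurableSet[m' ⊔ m₂] t) (x y : Ω) (hxy : f x = f y)
    (hx : x ∈ t) (hy : y ∉ t) : ¬ CondIndep m' m₁ m₂ hm' μ := by
  intro h
  rw [condIndep_iff_condExp_sup _ h₁ h₂] at h
  have h1 := h t ht₁
  rw [condExp_of_stronglyMeasurable (sup_le hm' h₂) (stronglyMeasurable_const.indicator ht₂)
    ((integrable_const 1).indicator (h₁ t ht₁))] at h1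
  have h2 := hμ _ h1
  obtain ⟨k, -, hk⟩ := Measurable.exists_eq_measurable_comp (f := f)
    (stronglyMeasurable_condExp (f := t.indicator fun _ => (1 : ℝ)) (μ := μ).mono hle).measurable
  have h3 := h2 x
  have h4 := h2 y
  rw [hk, Function.comp_apply, Set.indicator_of_mem hx] at h3
  rw [hk, Function.comp_apply, Set.indicator_of_notMem hy, ← hxy, ← h3] at h4
  exact zero_ne_one h4

variable {V : Type*} [Finite V]

lemma MarkovEquiv.famMarkov_coins {G H : DAG V} (h : MarkovEquiv G H) (c : V → Bool × Bool → Bool)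
    (hG : G.FamMarkov twoCoins (fun a => coinAlgebra (c a)) fun _ => coinAlgebra_le_top _) :
    H.FamMarkov twoCoins (fun a => coinAlgebra (c a)) fun _ => coinAlgebra_le_top _ :=
  h.famMarkov (T := fun ω a => if c a ω = true then (1 : ℝ) else 0)
    (measurable_of_finite _) hG

/-- Markov equivalent DAGs have the same skeleton. An edge is detected by a fair coin that is shared
by its two ends. -/
lemma MarkovEquiv.adj_or_adj {G H : DAG V} (h : MarkovEquiv G H) {u v : V} (huv : G.Adj u v) :
    H.Adj u v ∨ H.Adj v u := by
  classical
  by_contra hc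
  push Not at hc
  have hne : u ≠ v := fun h => G.not_adj_self v (h ▸ huv)
  set c : V → Bool × Bool → Bool := fun a ω => if a = u ∨ a = v then ω.1 else false with hcdef
  have hcu : c u = Prod.fst := by ext ω; simp [hcdef]
  have hcv : c v = Prod.fst := by ext ω; simp [hcdef]
  have hco : ∀ a, a ≠ u → a ≠ v → coinAlgebra (c a) = ⊥ := fun a hau hav => by
    have : c a = fun _ => false := by ext ω; simp [hcdef, hau, hav]
    rw [this, coinAlgebra_const]
  have hsup : ∀ S : Set V, u ∉ S → v ∉ S → ⨆ w ∈ S, coinAlgebra (c w) = ⊥ := by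
    intro S hu hv
    refine le_bot_iff.1 (iSup₂_le fun w hw => ?_)
    rw [hco w (fun h => hu (h ▸ hw)) (fun h => hv (h ▸ hw))]
  have hG : G.FamMarkov twoCoins (fun a => coinAlgebra (c a)) fun _ => coinAlgebra_le_top _ := by
    intro a
    by_cases hau : a = u
    · subst hau
      have := condIndep_bot_right (μ := twoCoins) (hm' := (iSup₂_le fun w _ =>
        coinAlgebra_le_top (c w) : ⨆ w ∈ G.parents a, coinAlgebra (c w) ≤ _)) (coinAlgebra (c a))
      rwa [← hsup (G.nonDescendants a) (fun h => h Relation.ReflTransGen.refl)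
        (fun h => h (Relation.ReflTransGen.single huv))] at this
    · by_cases hav : a = v
      · subst hav
        refine condIndep_of_le_cond _ (iSup₂_le fun w _ => coinAlgebra_le_top _) ?_
        calc coinAlgebra (c a) = coinAlgebra (c u) := by rw [hcu, hcv]
          _ ≤ _ := le_biSup (fun w => coinAlgebra (c w)) (show u ∈ G.parents a from huv)
      · refine condIndep_of_le_cond _ (iSup₂_le fun w _ => coinAlgebra_le_top _) ?_
        change coinAlgebra (c a) ≤ _
        rw [hco a hau hav]
        exact bot_le
  have hH := h.famMarkov_coins c hG
  -- one of the two vertices is not a descendant of the other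
  have contra : ∀ a b, c a = Prod.fst → c b = Prod.fst → a ∉ H.parents a → u ∉ H.parents a →
      v ∉ H.parents a → b ∈ H.nonDescendants a → False := by
    intro a b hca hcb _ hu hv hb
    refine not_condIndep_of_not_separated (t := {ω | ω.1 = true}) (f := fun _ => 0)
      (fun _ => forall_of_ae_twoCoins) _ (coinAlgebra_le_top _)
      (iSup₂_le fun w _ => coinAlgebra_le_top _) ?_ ?_ ?_ (true, true) (false, true) rfl rfl
      (by simp) (hH a)
    · rw [hsup _ hu hv]
      exact bot_le
    · rw [hca]
      exact measurableSet_coinAlgebra Prod.fst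
    · have h1 : coinAlgebra (c b) ≤ _ := (le_biSup (fun w => coinAlgebra (c w)) hb).trans
        (le_sup_right (a := ⨆ w ∈ H.parents a, coinAlgebra (c w)))
      rw [hcb] at h1
      exact h1 _ (measurableSet_coinAlgebra Prod.fst)
  by_cases hd : Relation.ReflTransGen H.Adj u v
  · refine contra v u hcv hcu (H.not_adj_self v) hc.1 (H.not_adj_self v) fun hd' => ?_
    rcases Relation.reflTransGen_iff_eq_or_transGen.1 hd with h' | h'
    · exact hne h'.symm
    · exact H.acyclic u (h'.trans_left hd')
  · exact contra u v hcu hcv (H.not_adj_self u) (H.not_adj_self u) hc.2 hd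

/-- Markov equivalent DAGs have the same v-structures. A v-structure `u → v ← w` is detected by two
independent coins at `u` and `w`, with `v` telling whether they differ. -/
lemma MarkovEquiv.adj_of_vStructure {G H : DAG V} (h : MarkovEquiv G H) {u v w : V}
    (huv : G.Adj u v) (hwv : G.Adj w v) (huw : u ≠ w) (hn : ¬ G.Adj u w) (hn' : ¬ G.Adj w u) :
    H.Adj u v := by
  classical
  rcases h.adj_or_adj huv with hvu | hvu
  · exact hvu
  exfalso
  have hneu : u ≠ v := fun h => G.not_adj_self v (h ▸ huv)
  have hvu' : ¬ G.Adj v u := G.not_adj_symm huv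
  have hvw' : ¬ G.Adj v w := G.not_adj_symm hwv
  have hnew : w ≠ v := fun h => G.not_adj_self v (h ▸ hwv)
  set c : V → Bool × Bool → Bool := fun a ω =>
    if a = u then ω.1 else if a = w then ω.2 else if a = v then xor ω.1 ω.2 else false with hcdef
  have hcu : c u = Prod.fst := by ext ω; simp [hcdef]
  have hcw : c w = Prod.snd := by ext ω; simp [hcdef, huw.symm]
  have hcv : c v = fun ω => xor ω.1 ω.2 := by ext ω; simp [hcdef, hneu.symm, hnew.symm]
  have hco : ∀ a, a ≠ u → a ≠ v → a ≠ w → coinAlgebra (c a) = ⊥ := fun a hau hav haw => by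
    have : c a = fun _ => false := by ext ω; simp [hcdef, hau, hav, haw]
    rw [this, coinAlgebra_const]
  have hsup : ∀ (m : MeasurableSpace (Bool × Bool)) (S : Set V),
      (u ∈ S → coinAlgebra (c u) ≤ m) → (v ∈ S → coinAlgebra (c v) ≤ m) →
      (w ∈ S → coinAlgebra (c w) ≤ m) → ⨆ w ∈ S, coinAlgebra (c w) ≤ m := by
    intro m S hu hv hw
    refine iSup₂_le fun a ha => ?_
    by_cases hau : a = u
    · exact hau ▸ hu (hau ▸ ha)
    by_cases hav : a = v
    · exact hav ▸ hv (hav ▸ ha)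
    by_cases haw : a = w
    · exact haw ▸ hw (haw ▸ ha)
    rw [hco a hau hav haw]
    exact bot_le
  have hsupbot : ∀ S : Set V, u ∉ S → v ∉ S → w ∉ S → ⨆ w ∈ S, coinAlgebra (c w) = ⊥ :=
    fun S hu hv hw => le_bot_iff.1 (hsup ⊥ S (absurd · hu) (absurd · hv) (absurd · hw))
  have hind : CondIndep ⊥ (coinAlgebra Prod.fst) (coinAlgebra Prod.snd) bot_le twoCoins :=
    condIndep_bot_of_indep (coinAlgebra_le_top _) (coinAlgebra_le_top _) indep_fst_snd_twoCoins
  have hG : G.FamMarkov twoCoins (fun a => coinAlgebra (c a)) fun _ => coinAlgebra_le_top _ := by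
    intro a
    by_cases hau : a = u
    · subst hau
      refine (condIndep_of_condIndep_of_le_right
        (by beta_reduce; rw [hcu]; exact hind) ?_).congr_cond
        (hsupbot (G.parents a) (G.not_adj_self a) hvu' hn').symm _
      refine hsup _ _ (fun h => absurd Relation.ReflTransGen.refl h)
        (fun h => absurd (Relation.ReflTransGen.single huv) h) fun _ => ?_
      rw [hcw]
    by_cases haw : a = w
    · subst haw
      refine (condIndep_of_condIndep_of_le_right
        (by beta_reduce; rw [hcw]; exact hind.symm) ?_).congr_cond
        (hsupbot (G.parents a) hn hvw' (G.not_adj_self a)).symm _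
      refine hsup _ _ (fun _ => ?_)
        (fun h => absurd (Relation.ReflTransGen.single hwv) h)
        (fun h => absurd Relation.ReflTransGen.refl h)
      rw [hcu]
    refine condIndep_of_le_cond _ (iSup₂_le fun w _ => coinAlgebra_le_top _) ?_
    by_cases hav : a = v
    · subst hav
      have h1 : coinAlgebra (c u) ≤ ⨆ w ∈ G.parents a, coinAlgebra (c w) :=
        le_biSup (fun w => coinAlgebra (c w)) (show u ∈ G.parents a from huv)
      have h2 : coinAlgebra (c w) ≤ ⨆ w ∈ G.parents a, coinAlgebra (c w) :=
        le_biSup (fun w => coinAlgebra (c w)) (show w ∈ G.parents a from hwv)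
      rw [hcu] at h1
      rw [hcw] at h2
      change coinAlgebra (c a) ≤ _
      rw [hcv]
      exact coinAlgebra_le (measurableSet_coinAlgebra_xor _ h1 h2)
    · change coinAlgebra (c a) ≤ _
      rw [hco a hau hav haw]
      exact bot_le
  have hH := h.famMarkov_coins c hG
  have hHn : ¬ H.Adj u w := fun hc => (h.symm.adj_or_adj hc).elim hn hn'
  have hHn' : ¬ H.Adj w u := fun hc => (h.symm.adj_or_adj hc).elim hn' hn
  by_cases hd : Relation.ReflTransGen H.Adj u w
  · -- `u` is not a descendant of `w`, and `v` is a parent of `w`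
    have hnd : u ∈ H.nonDescendants w := fun hd' => by
      rcases Relation.reflTransGen_iff_eq_or_transGen.1 hd with h' | h'
      · exact huw h'.symm
      · exact H.acyclic u (h'.trans_left hd')
    have hvw : H.Adj v w := (h.adj_or_adj hwv).resolve_left fun hc =>
      H.acyclic v ((Relation.TransGen.head' hvu hd).tail hc)
    refine not_condIndep_of_not_separated (t := {ω | ω.2 = true})
      (f := fun ω => if xor ω.1 ω.2 = true then 1 else 0)
      (fun _ => forall_of_ae_twoCoins) _ (coinAlgebra_le_top _)
      (iSup₂_le fun w _ => coinAlgebra_le_top _) ?_ ?_ ?_ (false, true) (true, false) rfl rfl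
      (by simp) (hH w)
    · refine hsup _ _ (absurd · hHn) (fun _ => ?_) (absurd · (H.not_adj_self w))
      rw [hcv]
    · rw [hcw]
      exact measurableSet_coinAlgebra Prod.snd
    · have h1 : coinAlgebra (c u) ≤ _ := (le_biSup (fun w => coinAlgebra (c w)) hnd).trans
        (le_sup_right (a := ⨆ x ∈ H.parents w, coinAlgebra (c x)))
      have h2 : coinAlgebra (c v) ≤ _ := (le_biSup (fun w => coinAlgebra (c w))
        (show v ∈ H.parents w from hvw)).trans
        (le_sup_left (b := ⨆ x ∈ H.nonDescendants w, coinAlgebra (c x)))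
      rw [hcu] at h1
      rw [hcv] at h2
      simpa using measurableSet_coinAlgebra_xor _ h1 h2
  · refine not_condIndep_of_not_separated (t := {ω | ω.1 = true})
      (f := fun ω => if xor ω.1 ω.2 = true then 1 else 0)
      (fun _ => forall_of_ae_twoCoins) _ (coinAlgebra_le_top _)
      (iSup₂_le fun w _ => coinAlgebra_le_top _) ?_ ?_ ?_ (true, false) (false, true) rfl rfl
      (by simp) (hH u)
    · refine hsup _ _ (absurd · (H.not_adj_self u)) (fun _ => ?_) (absurd · hHn')
      rw [hcv]
    · rw [hcu]
      exact measurableSet_coinAlgebra Prod.fst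
    · have h1 : coinAlgebra (c w) ≤ _ := (le_biSup (fun w => coinAlgebra (c w))
        (show w ∈ H.nonDescendants u from hd)).trans
        (le_sup_right (a := ⨆ x ∈ H.parents u, coinAlgebra (c x)))
      have h2 : coinAlgebra (c v) ≤ _ := (le_biSup (fun w => coinAlgebra (c w))
        (show v ∈ H.parents u from hvu)).trans
        (le_sup_left (b := ⨆ x ∈ H.nonDescendants u, coinAlgebra (c x)))
      rw [hcw] at h1
      rw [hcv] at h2
      convert measurableSet_coinAlgebra_xor _ h1 h2 using 1
      ext ⟨a, b⟩
      cases a <;> cases b <;> simp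

end Coins

end DAG

namespace DAG

/-! ### Interventional Markov equivalence classes -/

section IMEC

variable {V W : Type*} [Finite V] [Finite W] {G H : DAG V} {I J : Finset V}

instance : Finite (DAG V) :=
  Finite.of_injective (fun G : DAG V => G.Adj) fun _ _ h => ext_adj fun a b =>
    iff_of_eq (congrFun (congrFun h a) b)

lemma self_mem_iMEC (G : DAG V) (I : Finset V) : G ∈ G.iMEC I :=
  ⟨MarkovEquiv.refl _, fun _ _ => MarkovEquiv.refl _⟩

lemma iMEC_anti (G : DAG V) (h : I ⊆ J) : G.iMEC J ⊆ G.iMEC I :=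
  fun _ hH => ⟨hH.1, fun i hi => hH.2 i (h hi)⟩

lemma mem_unorientedEdges {e : V × V} :
    e ∈ G.unorientedEdges I ↔ G.Adj e.1 e.2 ∧ ∃ H ∈ G.iMEC I, ¬ H.Adj e.1 e.2 := by
  simp only [unorientedEdges, EssDirected, Set.mem_ofPred_eq]
  constructor
  · rintro ⟨h1, h2⟩
    refine ⟨h1, ?_⟩
    by_contra hc
    push Not at hc
    exact h2 ⟨h1, hc⟩
  · rintro ⟨h1, H, hH, h2⟩
    exact ⟨h1, fun h => h2 (h.2 H hH)⟩

lemma unorientedEdges_anti (G : DAG V) (h : I ⊆ J) :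
    G.unorientedEdges J ⊆ G.unorientedEdges I := fun e he => by
  rw [mem_unorientedEdges] at he ⊢
  exact ⟨he.1, he.2.imp fun H hH => ⟨G.iMEC_anti h hH.1, hH.2⟩⟩

lemma numUnoriented_anti (G : DAG V) (h : I ⊆ J) : G.numUnoriented J ≤ G.numUnoriented I :=
  Set.ncard_le_ncard (G.unorientedEdges_anti h) (Set.toFinite _)

lemma classSize_anti (G : DAG V) (h : I ⊆ J) : G.classSize J ≤ G.classSize I :=
  Set.ncard_le_ncard (G.iMEC_anti h) (Set.toFinite _)

lemma one_le_classSize (G : DAG V) (I : Finset V) : 1 ≤ G.classSize I :=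
  (Set.ncard_pos (Set.toFinite _)).2 ⟨G, G.self_mem_iMEC I⟩

lemma numUnoriented_eq_zero_iff : G.numUnoriented I = 0 ↔ G.unorientedEdges I = ∅ :=
  Set.ncard_eq_zero (Set.toFinite _)

lemma adj_or_adj_of_mem_iMEC (hH : H ∈ G.iMEC I) {a b : V} (h : G.Adj a b) :
    H.Adj a b ∨ H.Adj b a :=
  hH.1.adj_or_adj h

/-- A member of the class is determined by the orientations of the unoriented edges. -/
lemma classSize_le_two_pow (G : DAG V) (I : Finset V) : G.classSize I ≤ 2 ^ G.numUnoriented I := by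
  rw [numUnoriented, ← Set.ncard_powerset _ (Set.toFinite _), classSize]
  refine Set.ncard_le_ncard_of_injOn (fun H => {e | e ∈ G.unorientedEdges I ∧ H.Adj e.1 e.2})
    (fun H _ e he => he.1) ?_ (Set.toFinite _)
  have key : ∀ H ∈ G.iMEC I, ∀ K ∈ G.iMEC I,
      {e | e ∈ G.unorientedEdges I ∧ H.Adj e.1 e.2} =
        {e | e ∈ G.unorientedEdges I ∧ K.Adj e.1 e.2} → ∀ a b, H.Adj a b → K.Adj a b := by
    intro H hH K hK heq a b hab
    have hG : ∀ a b, G.Adj a b → (H.Adj a b ↔ K.Adj a b) := by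
      intro a b hG
      by_cases hu : (a, b) ∈ G.unorientedEdges I
      · have := Set.ext_iff.1 heq (a, b)
        simpa [hu] using this
      · rw [mem_unorientedEdges] at hu
        push Not at hu
        exact iff_of_true (hu hG H hH) (hu hG K hK)
    rcases hH.1.symm.adj_or_adj hab with h | h
    · exact (hG a b h).1 hab
    · exact (adj_or_adj_of_mem_iMEC hK h).resolve_left
        fun hc => H.not_adj_symm hab ((hG b a h).2 hc)
  exact fun H hH K hK heq => ext_adj fun a b =>
    ⟨key H hH K hK heq a b, key K hK H hH heq.symm a b⟩

/-- An intervention at `i` orients all edges at `i`. -/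
lemma adj_of_mem_iMEC_of_mem (hH : H ∈ G.iMEC I) {a b : V} (hab : G.Adj a b)
    (hI : a ∈ I ∨ b ∈ I) : H.Adj a b := by
  refine (adj_or_adj_of_mem_iMEC hH hab).resolve_right fun hba => ?_
  have hne : a ≠ b := fun h => G.not_adj_self b (h ▸ hab)
  rcases hI with hI | hI
  · rcases (hH.2 a hI).adj_or_adj (u := a) (v := b) ⟨hab, hne.symm⟩ with h | h
    · exact H.not_adj_symm hba h.1
    · exact h.2 rfl
  · rcases (hH.2 b hI).symm.adj_or_adj (u := b) (v := a) ⟨hba, hne⟩ with h | h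
    · exact G.not_adj_symm hab h.1
    · exact h.2 rfl

lemma numUnoriented_univ [Fintype V] (G : DAG V) : G.numUnoriented Finset.univ = 0 := by
  rw [numUnoriented_eq_zero_iff, Set.eq_empty_iff_forall_notMem]
  intro e he
  obtain ⟨h1, H, hH, h2⟩ := mem_unorientedEdges.1 he
  exact h2 (adj_of_mem_iMEC_of_mem hH h1 (Or.inl (Finset.mem_univ _)))

omit [Finite V] [Finite W] in
lemma comap_intervene (G : DAG V) {e : W → V} (he : Function.Injective e) (i : W) :
    (G.intervene (e i)).comap e = (G.comap e).intervene i :=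
  ext_adj fun _ _ => and_congr Iff.rfl he.ne_iff

lemma comap_mem_iMEC {e : W → V} (he : Function.Injective e) (hH : H ∈ G.iMEC I) {J : Finset W}
    (hJ : ∀ j ∈ J, e j ∈ I) : H.comap e ∈ (G.comap e).iMEC J :=
  ⟨hH.1.comap he, fun j hj => by
    rw [← comap_intervene G he, ← comap_intervene H he]
    exact (hH.2 _ (hJ j hj)).comap he⟩

end IMEC

section Optimal

variable {V : Type*} [Fintype V] {G : DAG V} {r : ℕ}

lemma exists_isInterventionSet_superset {J : Finset V} (hJ : J.card ≤ r) :
    ∃ I, J ⊆ I ∧ IsInterventionSet V r I :=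
  Finset.exists_superset_card_eq (le_min hJ J.card_le_univ) (min_le_right _ _)

lemma IsInterventionSet.card_le {I : Finset V} (h : IsInterventionSet V r I) : I.card ≤ r :=
  h.trans_le (min_le_left _ _)

lemma minUnoriented_le {I : Finset V} (h : IsInterventionSet V r I) :
    G.minUnoriented r ≤ G.numUnoriented I :=
  Nat.sInf_le ⟨I, h, rfl⟩

lemma minUnoriented_le_of_card_le {J : Finset V} (h : J.card ≤ r) :
    G.minUnoriented r ≤ G.numUnoriented J := by
  obtain ⟨I, hJI, hI⟩ := exists_isInterventionSet_superset h
  exact (minUnoriented_le hI).trans (G.numUnoriented_anti hJI)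

lemma exists_isEdgeOptimal (G : DAG V) (r : ℕ) : ∃ I, G.IsEdgeOptimal r I := by
  obtain ⟨I₀, -, hI₀⟩ := exists_isInterventionSet_superset (V := V) (J := ∅) (r := r) (by simp)
  obtain ⟨I, hI, h⟩ := Nat.sInf_mem (s := {m | ∃ I, IsInterventionSet V r I ∧
    m = G.numUnoriented I}) ⟨_, I₀, hI₀, rfl⟩
  exact ⟨I, hI, h.symm⟩

lemma minClassSize_le {I : Finset V} (h : IsInterventionSet V r I) :
    G.minClassSize r ≤ G.classSize I :=
  Nat.sInf_le ⟨I, h, rfl⟩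

lemma exists_classSize_eq_minClassSize (G : DAG V) (r : ℕ) :
    ∃ I, IsInterventionSet V r I ∧ G.classSize I = G.minClassSize r := by
  obtain ⟨I₀, -, hI₀⟩ := exists_isInterventionSet_superset (V := V) (J := ∅) (r := r) (by simp)
  obtain ⟨I, hI, h⟩ := Nat.sInf_mem (s := {m | ∃ I, IsInterventionSet V r I ∧
    m = G.classSize I}) ⟨_, I₀, hI₀, rfl⟩
  exact ⟨I, hI, h.symm⟩

lemma one_le_minClassSize (G : DAG V) (r : ℕ) : 1 ≤ G.minClassSize r := by
  obtain ⟨I, -, h⟩ := G.exists_classSize_eq_minClassSize r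
  exact h ▸ G.one_le_classSize I

lemma exists_card_eq_numInterventions (G : DAG V) :
    ∃ I : Finset V, I.card = G.numInterventions ∧ G.numUnoriented I = 0 :=
  Nat.sInf_mem (s := {m | ∃ I : Finset V, I.card = m ∧ G.numUnoriented I = 0})
    ⟨_, Finset.univ, rfl, G.numUnoriented_univ⟩

lemma numInterventions_le {I : Finset V} (h : G.numUnoriented I = 0) :
    G.numInterventions ≤ I.card :=
  Nat.sInf_le ⟨I, rfl, h⟩

/-- The smallest class size that an edge-optimal set of `r` interventions attains. -/
def minEdgeOptimalClassSize (G : DAG V) (r : ℕ) : ℕ :=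
  sInf {m | ∃ I, G.IsEdgeOptimal r I ∧ m = G.classSize I}

lemma exists_classSize_eq_minEdgeOptimalClassSize (G : DAG V) (r : ℕ) :
    ∃ I, G.IsEdgeOptimal r I ∧ G.classSize I = G.minEdgeOptimalClassSize r := by
  obtain ⟨I₀, hI₀⟩ := G.exists_isEdgeOptimal r
  obtain ⟨I, hI, h⟩ := Nat.sInf_mem (s := {m | ∃ I, G.IsEdgeOptimal r I ∧
    m = G.classSize I}) ⟨_, I₀, hI₀, rfl⟩
  exact ⟨I, hI, h.symm⟩

lemma minEdgeOptimalClassSize_le {I : Finset V} (h : G.IsEdgeOptimal r I) :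
    G.minEdgeOptimalClassSize r ≤ G.classSize I :=
  Nat.sInf_le ⟨I, h, rfl⟩

lemma IsEdgeOptimal.classSize_le_two_pow {I : Finset V} (h : G.IsEdgeOptimal r I) :
    G.classSize I ≤ 2 ^ G.minUnoriented r :=
  h.2 ▸ G.classSize_le_two_pow I

lemma minClassSize_le_two_pow (G : DAG V) (r : ℕ) :
    G.minClassSize r ≤ 2 ^ G.minUnoriented r := by
  obtain ⟨I, hI⟩ := G.exists_isEdgeOptimal r
  exact (minClassSize_le hI.1).trans hI.classSize_le_two_pow

end Optimal

/-! ### Adding a sink -/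

section AddSink

variable {n : ℕ}

/-- The DAG that arises from `G` by a new last vertex with the set `S` of parents. -/
def addSink (G : DAG (Fin n)) (S : Set (Fin n)) : DAG (Fin (n + 1)) where
  Adj a b := ∃ a' : Fin n, a'.castSucc = a ∧
    ((∃ b' : Fin n, b'.castSucc = b ∧ G.Adj a' b') ∨ (b = Fin.last n ∧ a' ∈ S))
  acyclic v h := by
    have key : ∀ a b, Relation.TransGen (fun a b => ∃ a' : Fin n, a'.castSucc = a ∧
        ((∃ b' : Fin n, b'.castSucc = b ∧ G.Adj a' b') ∨ (b = Fin.last n ∧ a' ∈ S))) a b →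
        ∃ a' : Fin n, a'.castSucc = a ∧
          ∀ b' : Fin n, b'.castSucc = b → Relation.TransGen G.Adj a' b' := by
      have hstep : ∀ (a' : Fin n) (b b' : Fin (n + 1)),
          ((∃ b' : Fin n, b'.castSucc = b ∧ G.Adj a' b') ∨ (b = Fin.last n ∧ a' ∈ S)) →
          ∀ b' : Fin n, b'.castSucc = b → G.Adj a' b' := by
        rintro a' b - (⟨c, rfl, hc⟩ | ⟨rfl, -⟩) b' hb'
        · rwa [Fin.castSucc_injective n hb']
        · exact absurd hb' b'.castSucc_ne_last
      intro a b hab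
      induction hab with
      | single h =>
        obtain ⟨a', ha', h⟩ := h
        exact ⟨a', ha', fun b' hb' => .single (hstep a' _ b'.castSucc h b' hb')⟩
      | tail _ h ih =>
        obtain ⟨c', hc', h⟩ := h
        obtain ⟨a', ha', ih⟩ := ih
        exact ⟨a', ha', fun b' hb' => (ih c' hc').tail (hstep c' _ b'.castSucc h b' hb')⟩
    obtain ⟨v', hv', h'⟩ := key v v h
    exact G.acyclic v' (h' v' hv')

variable {G H : DAG (Fin n)} {S : Set (Fin n)}

@[simp]
lemma addSink_adj_castSucc {a b : Fin n} :
    (G.addSink S).Adj a.castSucc b.castSucc ↔ G.Adj a b := by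
  constructor
  · rintro ⟨a', ha', ⟨b', hb', h⟩ | ⟨hb', -⟩⟩
    · rwa [← Fin.castSucc_injective n ha', ← Fin.castSucc_injective n hb']
    · exact absurd hb' b.castSucc_ne_last
  · exact fun h => ⟨a, rfl, Or.inl ⟨b, rfl, h⟩⟩

@[simp]
lemma addSink_adj_last {a : Fin n} : (G.addSink S).Adj a.castSucc (Fin.last n) ↔ a ∈ S := by
  constructor
  · rintro ⟨a', ha', ⟨b', hb', -⟩ | ⟨-, h⟩⟩
    · exact absurd hb' b'.castSucc_ne_last
    · rwa [← Fin.castSucc_injective n ha']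
  · exact fun h => ⟨a, rfl, Or.inr ⟨rfl, h⟩⟩

@[simp]
lemma not_addSink_last_adj (G : DAG (Fin n)) (S : Set (Fin n)) (b : Fin (n + 1)) :
    ¬ (G.addSink S).Adj (Fin.last n) b := by
  rintro ⟨a', ha', -⟩
  exact a'.castSucc_ne_last ha'

@[simp]
lemma comap_addSink (G : DAG (Fin n)) (S : Set (Fin n)) :
    (G.addSink S).comap Fin.castSucc = G :=
  ext_adj fun _ _ => addSink_adj_castSucc

lemma eq_addSink {K : DAG (Fin (n + 1))} (hK : ∀ b, ¬ K.Adj (Fin.last n) b) :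
    K = (K.comap Fin.castSucc).addSink {u | K.Adj u.castSucc (Fin.last n)} := by
  refine ext_adj fun a b => ?_
  induction a using Fin.lastCases with
  | last => exact iff_of_false (hK b) (not_addSink_last_adj _ _ b)
  | cast a =>
    induction b using Fin.lastCases with
    | last => exact (addSink_adj_last (S := {u | K.Adj u.castSucc (Fin.last n)})).symm
    | cast b => exact (addSink_adj_castSucc (G := K.comap Fin.castSucc)).symm

lemma intervene_castSucc_addSink (i : Fin n) :
    (G.addSink S).intervene i.castSucc = (G.intervene i).addSink S := by
  refine ext_adj fun a b => ?_
  induction a using Fin.lastCases with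
  | last =>
    exact iff_of_false (fun h => not_addSink_last_adj G S b (And.left h))
      (not_addSink_last_adj _ _ b)
  | cast a =>
    induction b using Fin.lastCases with
    | last => simp [intervene, (Fin.castSucc_ne_last i).symm]
    | cast b => simp [intervene]

lemma intervene_last_addSink : (G.addSink S).intervene (Fin.last n) = G.addSink ∅ := by
  refine ext_adj fun a b => ?_
  induction a using Fin.lastCases with
  | last =>
    exact iff_of_false (fun h => not_addSink_last_adj G S b (And.left h))
      (not_addSink_last_adj _ _ b)
  | cast a =>
    induction b using Fin.lastCases with
    | last => simp [intervene]
    | cast b => simp [intervene]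

lemma MarkovEquiv.addSink (h : MarkovEquiv G H) (S : Set (Fin n)) :
    MarkovEquiv (G.addSink S) (H.addSink S) := by
  refine MarkovEquiv.of_comap_sink (Fin.castSucc_injective n) (v := Fin.last n) ?_
    (not_addSink_last_adj G S) (not_addSink_last_adj H S) ?_ (by simpa using h)
  · ext a
    induction a using Fin.lastCases with
    | last => simp
    | cast a => simp [Fin.castSucc_ne_last]
  · ext a
    induction a using Fin.lastCases with
    | last => simp [mem_parents]
    | cast a => simp [mem_parents]

lemma addSink_mem_iMEC {J : Finset (Fin (n + 1))} {J' : Finset (Fin n)}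
    (hJ : ∀ i, i ∈ J' ↔ i.castSucc ∈ J) (hH : H ∈ G.iMEC J') (S : Set (Fin n)) :
    H.addSink S ∈ (G.addSink S).iMEC J := by
  refine ⟨hH.1.addSink S, fun i hi => ?_⟩
  induction i using Fin.lastCases with
  | last =>
    rw [intervene_last_addSink, intervene_last_addSink]
    exact hH.1.addSink ∅
  | cast i =>
    rw [intervene_castSucc_addSink, intervene_castSucc_addSink]
    exact (hH.2 i ((hJ i).2 hi)).addSink S

end AddSink

/-! ### The effect of a new sink on the metrics -/

section Metrics

variable {n : ℕ}

/-- The tails of the edges into the last vertex that are not part of a v-structure with this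
vertex. -/
def shieldedParents (G : DAG (Fin (n + 1))) : Set (Fin n) :=
  {u | G.Adj u.castSucc (Fin.last n) ∧ ∀ w, w ≠ u → G.Adj w.castSucc (Fin.last n) →
    G.Adj w.castSucc u.castSucc ∨ G.Adj u.castSucc w.castSucc}

variable {G H : DAG (Fin (n + 1))} {J : Finset (Fin (n + 1))} {J' : Finset (Fin n)} {r : ℕ}

lemma adj_last_of_mem_iMEC (hH : H ∈ G.iMEC J) {u : Fin n}
    (hu : G.Adj u.castSucc (Fin.last n)) (h : u ∉ G.shieldedParents) :
    H.Adj u.castSucc (Fin.last n) := by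
  simp only [shieldedParents, Set.mem_ofPred_eq, not_and, not_forall, not_or] at h
  obtain ⟨w, hwu, hw, h1, h2⟩ := h hu
  exact hH.1.adj_of_vStructure hu hw (fun h => hwu (Fin.castSucc_injective n h).symm) h2 h1

section

variable (hG : ∀ b, ¬ G.Adj (Fin.last n) b) (hJ : ∀ i, i ∈ J' ↔ i.castSucc ∈ J)

include hG

include hJ in
/-- Edges that are unoriented before the sink is added stay unoriented, since members of the class
extend by the sink. -/
lemma numUnoriented_comap_le :
    (G.comap Fin.castSucc).numUnoriented J' ≤ G.numUnoriented J := by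
  refine Set.ncard_le_ncard_of_injOn (fun e => (e.1.castSucc, e.2.castSucc)) ?_ ?_ (Set.toFinite _)
  · intro e he
    obtain ⟨h1, H, hH, h2⟩ := mem_unorientedEdges.1 he
    refine mem_unorientedEdges.2 ⟨h1, H.addSink {u | G.Adj u.castSucc (Fin.last n)}, ?_, ?_⟩
    · have := addSink_mem_iMEC hJ hH {u | G.Adj u.castSucc (Fin.last n)}
      rwa [← eq_addSink hG] at this
    · simpa using h2
  · intro e _ f _ h
    simp only [Prod.mk.injEq, Fin.castSucc_inj] at h
    exact Prod.ext h.1 h.2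

include hJ in
lemma classSize_comap_le : (G.comap Fin.castSucc).classSize J' ≤ G.classSize J := by
  refine Set.ncard_le_ncard_of_injOn
    (fun H => H.addSink {u | G.Adj u.castSucc (Fin.last n)}) ?_ ?_ (Set.toFinite _)
  · intro H hH
    have := addSink_mem_iMEC hJ hH {u | G.Adj u.castSucc (Fin.last n)}
    rwa [← eq_addSink hG] at this
  · intro H _ K _ h
    have := congrArg (fun L => L.comap Fin.castSucc) h
    simpa using this

include hJ in
/-- Edges that are oriented before the sink is added stay oriented, since members of the class
restrict; the edges into the sink are oriented by v-structures or by an intervention. -/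
lemma unorientedEdges_subset : G.unorientedEdges J ⊆
    (fun e : Fin n × Fin n => (e.1.castSucc, e.2.castSucc)) ''
        (G.comap Fin.castSucc).unorientedEdges J' ∪
      (fun u : Fin n => (u.castSucc, Fin.last n)) '' {u ∈ G.shieldedParents | Fin.last n ∉ J} := by
  rintro ⟨a, b⟩ he
  obtain ⟨h1, H, hH, h2⟩ := mem_unorientedEdges.1 he
  induction a using Fin.lastCases with
  | last => exact absurd h1 (hG b)
  | cast a =>
    induction b using Fin.lastCases with
    | last =>
      refine Or.inr ⟨a, ⟨?_, fun hl => ?_⟩, rfl⟩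
      · by_contra hc
        exact h2 (adj_last_of_mem_iMEC hH h1 hc)
      · exact h2 (adj_of_mem_iMEC_of_mem hH h1 (Or.inr hl))
    | cast b =>
      refine Or.inl ⟨(a, b), mem_unorientedEdges.2 ⟨h1, H.comap Fin.castSucc, ?_, h2⟩, rfl⟩
      exact comap_mem_iMEC (Fin.castSucc_injective n) hH fun j hj => (hJ j).1 hj

include hJ in
lemma numUnoriented_le_add :
    G.numUnoriented J ≤ (G.comap Fin.castSucc).numUnoriented J' + G.shieldedParents.ncard := by
  refine (Set.ncard_le_ncard (unorientedEdges_subset hG hJ) (Set.toFinite _)).trans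
    ((Set.ncard_union_le _ _).trans (Nat.add_le_add
      (Set.ncard_image_le (Set.toFinite _)) ((Set.ncard_image_le (Set.toFinite _)).trans
      (Set.ncard_le_ncard (fun _ h => h.1) (Set.toFinite _)))))

include hJ in
lemma numUnoriented_le_of_last_mem (hl : Fin.last n ∈ J) :
    G.numUnoriented J ≤ (G.comap Fin.castSucc).numUnoriented J' := by
  refine (Set.ncard_le_ncard (unorientedEdges_subset hG hJ) (Set.toFinite _)).trans ?_
  simp only [hl, not_true_eq_false, and_false, Set.ofPred_false, Set.image_empty, Set.union_empty]
  exact Set.ncard_image_le (Set.toFinite _)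

include hJ in
/-- Without shielded parents, all members of the class agree at the sink, so that they are
determined by their restrictions. -/
lemma classSize_le_comap (h0 : G.shieldedParents = ∅) :
    G.classSize J ≤ (G.comap Fin.castSucc).classSize J' := by
  refine Set.ncard_le_ncard_of_injOn (fun H => H.comap Fin.castSucc) ?_ ?_ (Set.toFinite _)
  · exact fun H hH => comap_mem_iMEC (Fin.castSucc_injective n) hH fun j hj => (hJ j).1 hj
  · have hlast : ∀ H ∈ G.iMEC J, (∀ b, ¬ H.Adj (Fin.last n) b) ∧
        {u | H.Adj u.castSucc (Fin.last n)} = {u : Fin n | G.Adj u.castSucc (Fin.last n)} := by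
      intro H hH
      have hin : ∀ u : Fin n, G.Adj u.castSucc (Fin.last n) → H.Adj u.castSucc (Fin.last n) :=
        fun u hu => adj_last_of_mem_iMEC hH hu (h0 ▸ Set.notMem_empty u)
      constructor
      · intro b hb
        induction b using Fin.lastCases with
        | last => exact H.not_adj_self _ hb
        | cast b =>
          exact H.not_adj_symm hb (hin b ((hH.1.symm.adj_or_adj hb).resolve_left (hG _)))
      · ext u
        exact ⟨fun hu => (hH.1.symm.adj_or_adj hu).resolve_right (hG _), hin u⟩
    intro H hH K hK h
    rw [eq_addSink (hlast H hH).1, eq_addSink (hlast K hK).1, (hlast H hH).2, (hlast K hK).2]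
    exact congrArg (fun L => addSink L {u : Fin n | G.Adj u.castSucc (Fin.last n)}) h

end

lemma exists_restrict (J : Finset (Fin (n + 1))) :
    ∃ J' : Finset (Fin n), (∀ i, i ∈ J' ↔ i.castSucc ∈ J) ∧ J'.card ≤ J.card := by
  classical
  refine ⟨Finset.univ.filter fun i => i.castSucc ∈ J, by simp, ?_⟩
  exact Finset.card_le_card_of_injOn Fin.castSucc (fun i hi => (Finset.mem_filter.1 hi).2)
    (Fin.castSucc_injective n).injOn

lemma mem_iff_castSucc_mem_map (I : Finset (Fin n)) (i : Fin n) :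
    i ∈ I ↔ i.castSucc ∈ I.map Fin.castSuccEmb := by
  simp

lemma minUnoriented_comap_le (hG : ∀ b, ¬ G.Adj (Fin.last n) b) (r : ℕ) :
    (G.comap Fin.castSucc).minUnoriented r ≤ G.minUnoriented r := by
  obtain ⟨J, hJ, hJ'⟩ := G.exists_isEdgeOptimal r
  obtain ⟨I, hI, hc⟩ := exists_restrict J
  rw [← hJ']
  exact (minUnoriented_le_of_card_le (hc.trans hJ.card_le)).trans (numUnoriented_comap_le hG hI)

lemma minUnoriented_le_add (hG : ∀ b, ¬ G.Adj (Fin.last n) b) (r : ℕ) :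
    G.minUnoriented r ≤ (G.comap Fin.castSucc).minUnoriented r + G.shieldedParents.ncard := by
  obtain ⟨I, hI, hI'⟩ := (G.comap Fin.castSucc).exists_isEdgeOptimal r
  rw [← hI']
  exact (minUnoriented_le_of_card_le (by simpa using hI.card_le)).trans
    (numUnoriented_le_add hG (mem_iff_castSucc_mem_map I))

lemma numInterventions_comap_le (hG : ∀ b, ¬ G.Adj (Fin.last n) b) :
    (G.comap Fin.castSucc).numInterventions ≤ G.numInterventions := by
  obtain ⟨J, hJ, hJ'⟩ := G.exists_card_eq_numInterventions
  obtain ⟨I, hI, hc⟩ := exists_restrict J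
  refine (numInterventions_le ?_).trans (hc.trans hJ.le)
  have := numUnoriented_comap_le hG hI
  omega

/-- If the new sink has a shielded parent, then one further intervention at the sink suffices. -/
lemma numInterventions_le_add (hG : ∀ b, ¬ G.Adj (Fin.last n) b) :
    G.numInterventions ≤ (G.comap Fin.castSucc).numInterventions + G.shieldedParents.ncard := by
  classical
  obtain ⟨I, hI, hI'⟩ := (G.comap Fin.castSucc).exists_card_eq_numInterventions
  rw [← hI]
  rcases Nat.eq_zero_or_pos G.shieldedParents.ncard with h0 | h0
  · have h1 := numUnoriented_le_add hG (mem_iff_castSucc_mem_map I)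
    have h2 := numInterventions_le (G := G) (I := I.map Fin.castSuccEmb) (by omega)
    rw [Finset.card_map] at h2
    omega
  · have h1 := numUnoriented_le_of_last_mem hG
      (J := insert (Fin.last n) (I.map Fin.castSuccEmb)) (J' := I) (fun i => by simp)
      (Finset.mem_insert_self _ _)
    have h2 := numInterventions_le (G := G)
      (I := insert (Fin.last n) (I.map Fin.castSuccEmb)) (by omega)
    have h3 := Finset.card_insert_le (Fin.last n) (I.map Fin.castSuccEmb)
    rw [Finset.card_map] at h3
    omega

lemma minClassSize_comap_le (hG : ∀ b, ¬ G.Adj (Fin.last n) b) (r : ℕ) :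
    (G.comap Fin.castSucc).minClassSize r ≤ G.minClassSize r := by
  obtain ⟨J, hJ, hJ'⟩ := G.exists_classSize_eq_minClassSize r
  obtain ⟨J', hJJ, hc⟩ := exists_restrict J
  obtain ⟨I, hJI, hI⟩ := exists_isInterventionSet_superset (hc.trans hJ.card_le)
  rw [← hJ']
  exact (minClassSize_le hI).trans ((classSize_anti _ hJI).trans (classSize_comap_le hG hJJ))

lemma minClassSize_eq_comap (hG : ∀ b, ¬ G.Adj (Fin.last n) b) (h0 : G.shieldedParents = ∅)
    (r : ℕ) : G.minClassSize r = (G.comap Fin.castSucc).minClassSize r := by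
  refine le_antisymm ?_ (minClassSize_comap_le hG r)
  obtain ⟨I, hI, hI'⟩ := (G.comap Fin.castSucc).exists_classSize_eq_minClassSize r
  obtain ⟨J, hIJ, hJ⟩ := exists_isInterventionSet_superset (V := Fin (n + 1)) (r := r)
    (J := I.map Fin.castSuccEmb) (by simpa using hI.card_le)
  rw [← hI']
  exact (minClassSize_le hJ).trans ((classSize_anti _ hIJ).trans
    (classSize_le_comap hG (mem_iff_castSucc_mem_map I) h0))

/-- For `r ≤ n` an edge-optimal set of `r` old vertices stays edge-optimal. For `r > n` the sizes of
the admissible sets before and after the addition differ. -/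
lemma minEdgeOptimalClassSize_eq_comap (hG : ∀ b, ¬ G.Adj (Fin.last n) b)
    (h0 : G.shieldedParents = ∅) (hr : r ≤ n) :
    G.minEdgeOptimalClassSize r = (G.comap Fin.castSucc).minEdgeOptimalClassSize r := by
  have hX := minUnoriented_comap_le hG r
  apply le_antisymm
  · obtain ⟨I, hI, hI'⟩ := (G.comap Fin.castSucc).exists_classSize_eq_minEdgeOptimalClassSize r
    rw [← hI']
    refine (minEdgeOptimalClassSize_le (I := I.map Fin.castSuccEmb) ⟨?_, ?_⟩).trans
      (classSize_le_comap hG (mem_iff_castSucc_mem_map I) h0)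
    · have h1 := hI.1
      simp only [IsInterventionSet, Fintype.card_fin, Finset.card_map] at h1 ⊢
      omega
    · have h1 := numUnoriented_le_add hG (mem_iff_castSucc_mem_map I)
      rw [h0, Set.ncard_empty, hI.2] at h1
      refine le_antisymm (by omega) (minUnoriented_le_of_card_le ?_)
      simpa using hI.1.card_le
  · have hX' := minUnoriented_le_add hG r
    rw [h0, Set.ncard_empty] at hX'
    obtain ⟨J, hJ, hJ'⟩ := G.exists_classSize_eq_minEdgeOptimalClassSize r
    obtain ⟨J', hJJ, hc⟩ := exists_restrict J
    obtain ⟨I, hJI, hI⟩ := exists_isInterventionSet_superset (hc.trans hJ.1.card_le)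
    rw [← hJ']
    refine (minEdgeOptimalClassSize_le ⟨hI, ?_⟩).trans
      ((classSize_anti _ hJI).trans (classSize_comap_le hG hJJ))
    have h1 := numUnoriented_comap_le hG hJJ
    have h2 := (G.comap Fin.castSucc).numUnoriented_anti hJI
    have h3 := minUnoriented_le (G := G.comap Fin.castSucc) hI
    have h4 := hJ.2
    omega

end Metrics

end DAG

/-! ### The error terms -/

section Gap

variable {q : ℝ}

lemma hasSum_add_mul_pow_pred (hq₀ : 0 < q) (hq₁ : q < 1) (n : ℕ) :
    HasSum (fun k : ℕ => ((n + k : ℕ) : ℝ) * q ^ (n + k - 1))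
      (n * q ^ (n - 1) / (1 - q) + q ^ n / (1 - q) ^ 2) := by
  have hg : HasSum (fun k : ℕ => q ^ k) (1 - q)⁻¹ := hasSum_geometric_of_lt_one hq₀.le hq₁
  have hd : HasSum (fun k : ℕ => (k : ℝ) * q ^ k) (q / (1 - q) ^ 2) :=
    hasSum_coe_mul_geometric_of_norm_lt_one (by rwa [Real.norm_of_nonneg hq₀.le])
  have h := ((hg.mul_left (n : ℝ)).add hd).mul_left (q ^ n / q)
  have hq : 1 - q ≠ 0 := (sub_pos.2 hq₁).ne'
  have hfun : (fun k : ℕ => ((n + k : ℕ) : ℝ) * q ^ (n + k - 1)) =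
      fun k : ℕ => q ^ n / q * ((n : ℝ) * q ^ k + k * q ^ k) := by
    funext k
    rcases Nat.eq_zero_or_pos (n + k) with h0 | h0
    · obtain ⟨rfl, rfl⟩ : n = 0 ∧ k = 0 := by omega
      simp
    · have : q ^ (n + k) = q ^ (n + k - 1) * q := by
        rw [← pow_succ, Nat.sub_add_cancel h0]
      rw [eq_div_of_mul_eq hq₀.ne' this.symm, pow_add]
      push_cast
      ring
  have hval : n * q ^ (n - 1) / (1 - q) + q ^ n / (1 - q) ^ 2 =
      q ^ n / q * (n * (1 - q)⁻¹ + q / (1 - q) ^ 2) := by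
    rcases n with _ | n
    · field_simp
      simp
    · rw [Nat.add_sub_cancel, pow_succ]
      field_simp
  rw [hfun, hval]
  exact h

variable {ρ : ℝ}

lemma hasSum_gapTerm (hρ₀ : 0 < ρ) (hρ₁ : ρ < 1) (n : ℕ) :
    HasSum (fun k => gapTerm ρ (n + k)) (gapBound ρ n) := by
  have h1 : 0 < ρ * (1 - ρ) := mul_pos hρ₀ (sub_pos.2 hρ₁)
  have h2 : ρ * (1 - ρ) < 1 := by nlinarith
  have h := (hasSum_add_mul_pow_pred (q := 1 - ρ * (1 - ρ)) (by linarith) (by linarith) n).mul_left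
    ρ
  have h3 : 1 - ρ ≠ 0 := (sub_pos.2 hρ₁).ne'
  have hfun : (fun k => gapTerm ρ (n + k)) =
      fun k : ℕ => ρ * (((n + k : ℕ) : ℝ) * (1 - ρ * (1 - ρ)) ^ (n + k - 1)) := by
    funext k
    rw [gapTerm, mul_assoc]
  have hval : gapBound ρ n = ρ * (n * (1 - ρ * (1 - ρ)) ^ (n - 1) / (1 - (1 - ρ * (1 - ρ))) +
      (1 - ρ * (1 - ρ)) ^ n / (1 - (1 - ρ * (1 - ρ))) ^ 2) := by
    rw [gapBound, sub_sub_cancel]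
    field_simp
    ring
  rw [hfun, hval]
  exact h

lemma exists_gapBound_le (hρ₀ : 0 < ρ) (hρ₁ : ρ < 1) :
    ∃ C q : ℝ, 0 < q ∧ q < 1 ∧ ∀ n : ℕ, gapBound ρ n ≤ C * q ^ n := by
  set a : ℝ := 1 - ρ * (1 - ρ) with ha
  have h0 : 0 < 1 - ρ := sub_pos.2 hρ₁
  have h1 : 0 < ρ * (1 - ρ) := mul_pos hρ₀ h0
  have ha0 : 0 < a := by nlinarith
  have ha1 : a < 1 := by linarith
  -- any rate strictly between `a` and `1` absorbs the factor `n`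
  set q : ℝ := (1 + a) / 2 with hq
  have hq0 : 0 < q := by linarith
  have hq1 : q < 1 := by linarith
  have haq : a < q := by linarith
  have hlim : Tendsto (fun n : ℕ => (n : ℝ) * (a / q) ^ n) atTop (𝓝 0) :=
    tendsto_self_mul_const_pow_of_lt_one (by positivity) ((div_lt_one hq0).2 haq)
  obtain ⟨B, hB⟩ := hlim.bddAbove_range
  refine ⟨1 / (ρ * (1 - ρ) ^ 2) + B / a / (1 - ρ), q, hq0, hq1, fun n => ?_⟩
  have hn : (n : ℝ) * (a / q) ^ n ≤ B := hB ⟨n, rfl⟩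
  rw [div_pow, mul_div_assoc', div_le_iff₀ (by positivity)] at hn
  have hpow : a ^ n ≤ q ^ n := pow_le_pow_left₀ ha0.le haq.le n
  have hpred : (n : ℝ) * a ^ (n - 1) = n * a ^ n / a := by
    rcases n with _ | n
    · simp
    · rw [Nat.add_sub_cancel, pow_succ]
      field_simp
  rw [gapBound, ← ha, hpred, add_mul]
  refine add_le_add ?_ ?_
  · rw [div_mul_eq_mul_div, one_mul]
    gcongr
  · rw [div_mul_eq_mul_div, div_mul_eq_mul_div]
    gcongr

end Gap

/-! ### Almost sure limits of sequences with summable increments -/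

section Limit

variable {Ω : Type*} [MeasurableSpace Ω] {P : Measure Ω}

lemma ae_summable_and_integrable_tsum {D : ℕ → Ω → ℝ} (h0 : ∀ n ω, 0 ≤ D n ω)
    (hD : ∀ n, Integrable (D n) P) (hs : Summable fun n => ∫ ω, D n ω ∂P) :
    (∀ᵐ ω ∂P, Summable fun n => D n ω) ∧ Integrable (fun ω => ∑' n, D n ω) P := by
  have hm : ∀ n, AEMeasurable (fun ω => ENNReal.ofReal (D n ω)) P :=
    fun n => (hD n).aemeasurable.ennreal_ofReal
  have hfin : ∫⁻ ω, ∑' n, ENNReal.ofReal (D n ω) ∂P ≠ ⊤ := by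
    rw [lintegral_tsum hm]
    simp_rw [← fun n => ofReal_integral_eq_lintegral_ofReal (hD n) (ae_of_all _ (h0 n))]
    exact hs.tsum_ofReal_ne_top
  have htoReal : ∀ ω, (∑' n, ENNReal.ofReal (D n ω)).toReal = ∑' n, D n ω := fun ω => by
    rw [ENNReal.tsum_toReal_eq fun _ => ENNReal.ofReal_ne_top]
    exact tsum_congr fun n => ENNReal.toReal_ofReal (h0 n ω)
  constructor
  · filter_upwards [ae_lt_top' (AEMeasurable.tsum hm) hfin] with ω hω
    exact (ENNReal.summable_toReal hω.ne).congr fun n => ENNReal.toReal_ofReal (h0 n ω)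
  · exact (integrable_toReal_of_lintegral_ne_top (AEMeasurable.tsum hm) hfin).congr
      (ae_of_all _ htoReal)

/-- A sequence of integrable functions whose increments are bounded by functions with summable
integrals converges almost surely, and so do the integrals. -/
lemma exists_ae_limit_of_summable_increments {f D : ℕ → Ω → ℝ} {g : ℕ → ℝ}
    (hf : ∀ n, Integrable (f n) P) (hD : ∀ n, Integrable (D n) P)
    (hfD : ∀ n ω, |f (n + 1) ω - f n ω| ≤ D n ω) (hg : ∀ n, ∫ ω, D n ω ∂P ≤ g n)
    (hs : Summable g) :
    ∃ F : Ω → ℝ, (∀ᵐ ω ∂P, Tendsto (fun n => f n ω) atTop (𝓝 (F ω))) ∧ Integrable F P ∧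
      ∀ n, |∫ ω, F ω ∂P - ∫ ω, f n ω ∂P| ≤ ∑' k, g (n + k) := by
  have h0 : ∀ n ω, 0 ≤ D n ω := fun n ω => (abs_nonneg _).trans (hfD n ω)
  have hdist : ∀ ω n, dist (f n ω) (f n.succ ω) ≤ D n ω := fun ω n => by
    rw [dist_comm, Real.dist_eq]
    exact hfD n ω
  have hs' : Summable fun n => ∫ ω, D n ω ∂P :=
    Summable.of_nonneg_of_le (fun n => integral_nonneg (h0 n)) hg hs
  obtain ⟨hsum, hint⟩ := ae_summable_and_integrable_tsum h0 hD hs'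
  have hlim : ∀ᵐ ω ∂P, Tendsto (fun n => f n ω) atTop (𝓝 (limUnder atTop fun n => f n ω)) := by
    filter_upwards [hsum] with ω hω
    exact (cauchySeq_of_dist_le_of_summable _ (hdist ω) hω).tendsto_limUnder
  set F : Ω → ℝ := fun ω => limUnder atTop fun n => f n ω with hF
  have hbound : ∀ᵐ ω ∂P, ∀ n, ‖f n ω‖ ≤ |f 0 ω| + 2 * ∑' n, D n ω := by
    filter_upwards [hsum, hlim] with ω hω hω' n
    have e1 := dist_le_tsum_of_dist_le_of_tendsto₀ _ (hdist ω) hω hω'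
    have e2 := dist_le_tsum_of_dist_le_of_tendsto _ (hdist ω) hω hω' n
    have e3 : ∑' m, D (n + m) ω ≤ ∑' m, D m ω := by
      have h := hω.sum_add_tsum_nat_add n
      have hnn : 0 ≤ ∑ i ∈ Finset.range n, D i ω := Finset.sum_nonneg fun i _ => h0 i ω
      simp_rw [add_comm n]
      linarith
    rw [Real.dist_eq] at e1 e2
    rw [Real.norm_eq_abs]
    have := abs_le.1 e1
    have := abs_le.1 e2
    refine abs_le.2 ⟨?_, ?_⟩
    · have := neg_abs_le (f 0 ω)
      linarith
    · have := le_abs_self (f 0 ω)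
      linarith
  have hbint : Integrable (fun ω => |f 0 ω| + 2 * ∑' n, D n ω) P :=
    (hf 0).abs.add (hint.const_mul 2)
  have hFm : AEStronglyMeasurable F P :=
    aestronglyMeasurable_of_tendsto_ae atTop (fun n => (hf n).aestronglyMeasurable) hlim
  have hFint : Integrable F P := by
    refine hbint.mono' hFm ?_
    filter_upwards [hlim, hbound] with ω h1 h2
    exact le_of_tendsto h1.norm (Eventually.of_forall h2)
  refine ⟨F, hlim, hFint, fun n => ?_⟩
  have hconv : Tendsto (fun n => ∫ ω, f n ω ∂P) atTop (𝓝 (∫ ω, F ω ∂P)) :=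
    tendsto_integral_of_dominated_convergence _ (fun n => (hf n).aestronglyMeasurable) hbint
      (fun n => by filter_upwards [hbound] with ω h using h n) hlim
  have hinc : ∀ n, dist (∫ ω, f n ω ∂P) (∫ ω, f n.succ ω ∂P) ≤ g n := fun n => by
    rw [dist_comm, Real.dist_eq, ← integral_sub (hf _) (hf _)]
    refine (abs_integral_le_integral_abs).trans ((integral_mono ?_ (hD n) (hfD n)).trans (hg n))
    exact ((hf _).sub (hf _)).abs
  have := dist_le_tsum_of_dist_le_of_tendsto g hinc hs hconv n
  rwa [dist_comm, Real.dist_eq] at this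

end Limit

/-! ### Relabelling the vertices -/

namespace DAG

section Relabel

variable {V W : Type*} (G : DAG V) (e : W ≃ V) (I : Finset V) (r : ℕ)

lemma comap_comap_symm : (G.comap e).comap e.symm = G :=
  ext_adj fun a b => by simp

lemma comap_symm_comap (H : DAG W) : (H.comap e.symm).comap e = H :=
  ext_adj fun a b => by simp

lemma eq_comap_equiv_of_le {α : Type*} [PartialOrder α] {f : DAG V → α} {g : DAG W → α}
    (h₁ : ∀ G, g (G.comap e) ≤ f G) (h₂ : ∀ H, f (H.comap e.symm) ≤ g H) : g (G.comap e) = f G := by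
  refine le_antisymm (h₁ G) ?_
  have := h₂ (G.comap e)
  rwa [comap_comap_symm] at this

variable [Fintype V] [Fintype W]

lemma comap_symm_mem_iMEC {H : DAG W} (hH : H ∈ (G.comap e).iMEC (I.map e.symm.toEmbedding)) :
    H.comap e.symm ∈ G.iMEC I := by
  have := comap_mem_iMEC e.symm.injective hH (J := I) fun j hj => by simpa using hj
  rwa [comap_comap_symm] at this

lemma numUnoriented_comap_equiv_le :
    (G.comap e).numUnoriented (I.map e.symm.toEmbedding) ≤ G.numUnoriented I := by
  refine Set.ncard_le_ncard_of_injOn (fun x => (e x.1, e x.2)) ?_ ?_ (Set.toFinite _)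
  · intro x hx
    obtain ⟨h1, H, hH, h2⟩ := mem_unorientedEdges.1 hx
    exact mem_unorientedEdges.2
      ⟨h1, H.comap e.symm, G.comap_symm_mem_iMEC e I hH, by simpa using h2⟩
  · intro x _ y _ h
    simp only [Prod.mk.injEq, EmbeddingLike.apply_eq_iff_eq] at h
    exact Prod.ext h.1 h.2

lemma classSize_comap_equiv_le :
    (G.comap e).classSize (I.map e.symm.toEmbedding) ≤ G.classSize I := by
  refine Set.ncard_le_ncard_of_injOn (fun H => H.comap e.symm) ?_ ?_ (Set.toFinite _)
  · exact fun H hH => G.comap_symm_mem_iMEC e I hH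
  · intro H _ K _ h
    have := congrArg (fun L => L.comap e) h
    simpa only [comap_symm_comap] using this

variable {I} in
lemma isInterventionSet_map_equiv (h : IsInterventionSet V r I) :
    IsInterventionSet W r (I.map e.symm.toEmbedding) := by
  rw [IsInterventionSet, Finset.card_map, Fintype.card_congr e]
  exact h

lemma minUnoriented_comap_equiv_le : (G.comap e).minUnoriented r ≤ G.minUnoriented r := by
  obtain ⟨I, hI, hI'⟩ := G.exists_isEdgeOptimal r
  rw [← hI']
  exact (minUnoriented_le (isInterventionSet_map_equiv e r hI)).trans
    (G.numUnoriented_comap_equiv_le e I)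

lemma minUnoriented_comap_equiv : (G.comap e).minUnoriented r = G.minUnoriented r :=
  G.eq_comap_equiv_of_le e (f := fun G => G.minUnoriented r) (g := fun G => G.minUnoriented r)
    (fun G => G.minUnoriented_comap_equiv_le e r) fun H => H.minUnoriented_comap_equiv_le e.symm r

lemma minClassSize_comap_equiv_le : (G.comap e).minClassSize r ≤ G.minClassSize r := by
  obtain ⟨I, hI, hI'⟩ := G.exists_classSize_eq_minClassSize r
  rw [← hI']
  exact (minClassSize_le (isInterventionSet_map_equiv e r hI)).trans
    (G.classSize_comap_equiv_le e I)

lemma minClassSize_comap_equiv : (G.comap e).minClassSize r = G.minClassSize r :=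
  G.eq_comap_equiv_of_le e (f := fun G => G.minClassSize r) (g := fun G => G.minClassSize r)
    (fun G => G.minClassSize_comap_equiv_le e r) fun H => H.minClassSize_comap_equiv_le e.symm r

lemma numInterventions_comap_equiv_le : (G.comap e).numInterventions ≤ G.numInterventions := by
  obtain ⟨I, hI, hI'⟩ := G.exists_card_eq_numInterventions
  have h := G.numUnoriented_comap_equiv_le e I
  exact (numInterventions_le (I := I.map e.symm.toEmbedding) (by omega)).trans
    (by rw [Finset.card_map, hI])

lemma numInterventions_comap_equiv : (G.comap e).numInterventions = G.numInterventions :=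
  G.eq_comap_equiv_of_le e (f := fun G => G.numInterventions) (g := fun G => G.numInterventions)
    (fun G => G.numInterventions_comap_equiv_le e) fun H => H.numInterventions_comap_equiv_le e.symm

lemma isuEss_comap_equiv : (G.comap e).isuEss r = G.isuEss r := by
  rw [isuEss, isuEss, minUnoriented_comap_equiv]

end Relabel

end DAG

/-! ### The law of the coupled DAGs -/

section Law

/-- Events that depend on disjoint sets of independent σ-algebras are independent. -/
lemma ProbabilityTheory.iIndep.measureReal_biInter_of_pairwise_disjoint {Ω ι κ : Type*}
    {m : ι → MeasurableSpace Ω} {mΩ : MeasurableSpace Ω} {μ : Measure Ω} [IsProbabilityMeasure μ]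
    (h : iIndep m μ) (hm : ∀ i, m i ≤ mΩ) {S : κ → Set ι}
    (hS : Pairwise fun j k => Disjoint (S j) (S k))
    {E : κ → Set Ω} (hE : ∀ j, MeasurableSet[⨆ i ∈ S j, m i] (E j)) (T : Finset κ) :
    μ.real (⋂ j ∈ T, E j) = ∏ j ∈ T, μ.real (E j) := by
  classical
  induction T using Finset.induction_on with
  | empty => simp
  | insert j T hj ih =>
    have hdisj : Disjoint (S j) (⋃ k ∈ T, S k) := by
      refine Set.disjoint_iUnion₂_right.2 fun k hk => hS ?_
      rintro rfl
      exact hj hk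
    have hind := indep_iSup_of_disjoint hm h hdisj
    have hT : MeasurableSet[⨆ i ∈ ⋃ k ∈ T, S k, m i] (⋂ k ∈ T, E k) := by
      refine Finset.measurableSet_biInter (m := ⨆ i ∈ ⋃ k ∈ T, S k, m i) T fun k hk => ?_
      exact (biSup_mono fun i hi => Set.mem_biUnion hk hi :
        ⨆ i ∈ S k, m i ≤ ⨆ i ∈ ⋃ k ∈ T, S k, m i) _ (hE k)
    rw [Finset.set_biInter_insert, Finset.prod_insert hj, ← ih]
    have := (Indep_iff _ _ μ).1 hind _ _ (hE j) hT
    simp only [measureReal_def, this, ENNReal.toReal_mul]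

instance {V : Type*} [Finite V] : MeasurableSingletonClass (SimpleGraph V) where
  measurableSet_singleton G :=
    ⟨{G.Adj}, measurableSet_singleton _, by
      ext H
      exact ⟨fun h => SimpleGraph.ext h, fun h => h ▸ rfl⟩⟩

instance {V : Type*} [Finite V] : Finite (SimpleGraph V) :=
  Finite.of_injective SimpleGraph.Adj fun _ _ h => SimpleGraph.ext h

variable {Ω : Type*} {A : ℕ → ℕ → Ω → Bool} {n : ℕ}

/-- The undirected graph of the array `a`, with the vertex `u` at the position `σ u`. -/
def arraySkeleton (a : ℕ → ℕ → Bool) (σ : Equiv.Perm (Fin n)) : SimpleGraph (Fin n) where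
  Adj u v := (σ u < σ v ∧ a (σ u) (σ v) = true) ∨ (σ v < σ u ∧ a (σ v) (σ u) = true)
  symm := ⟨fun _ _ h => h.symm⟩
  loopless := ⟨fun _ h => h.elim (fun h => lt_irrefl _ h.1) fun h => lt_irrefl _ h.1⟩

lemma orientBy_arraySkeleton (a : ℕ → ℕ → Bool) (σ : Equiv.Perm (Fin n)) :
    orientBy (arraySkeleton a σ) σ = (arrayDAG a n).comap σ := by
  refine DAG.ext_adj fun u v => ?_
  change ((σ u < σ v ∧ _) ∨ (σ v < σ u ∧ _)) ∧ σ u < σ v ↔ σ u < σ v ∧ _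
  constructor
  · rintro ⟨h | h, h'⟩
    · exact h
    · exact absurd h.1 h'.not_gt
  · exact fun h => ⟨Or.inl h, h.1⟩

lemma card_filter_adj_eq_ncard_edgeSet (σ : Equiv.Perm (Fin n)) (H : SimpleGraph (Fin n))
    [DecidablePred fun p : {p : Fin n × Fin n // p.1 < p.2} =>
      H.Adj (σ.symm p.1.1) (σ.symm p.1.2)] :
    (Finset.univ.filter fun p : {p : Fin n × Fin n // p.1 < p.2} =>
      H.Adj (σ.symm p.1.1) (σ.symm p.1.2)).card = H.edgeSet.ncard := by
  rw [← Set.ncard_coe_finset]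
  refine Set.ncard_congr (fun p _ => s(σ.symm p.1.1, σ.symm p.1.2)) ?_ ?_ ?_
  · intro p hp
    simpa using hp
  · rintro ⟨⟨a, b⟩, hab⟩ ⟨⟨c, d⟩, hcd⟩ - - h
    simp only [Sym2.eq_iff, EmbeddingLike.apply_eq_iff_eq] at h
    rcases h with ⟨rfl, rfl⟩ | ⟨rfl, rfl⟩
    · rfl
    · exact absurd hab (lt_asymm hcd)
  · intro e he
    induction e with
    | _ a b =>
      rcases lt_trichotomy (σ a) (σ b) with h | h | h
      · exact ⟨⟨(σ a, σ b), h⟩, by simpa using he, by simp⟩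
      · exact absurd (σ.injective h) (H.ne_of_adj he)
      · exact ⟨⟨(σ b, σ a), h⟩, by simpa using he.symm, by simp [Sym2.eq_swap]⟩

lemma card_lt_pairs : Fintype.card {p : Fin n × Fin n // p.1 < p.2} = n.choose 2 := by
  classical
  have h := card_filter_adj_eq_ncard_edgeSet (1 : Equiv.Perm (Fin n)) ⊤
  rw [Finset.filter_true_of_mem fun p _ => by simpa using p.2.ne, Finset.card_univ] at h
  rw [h, ← SimpleGraph.coe_edgeFinset, Set.ncard_coe_finset,
    SimpleGraph.card_edgeFinset_top_eq_card_choose_two, Fintype.card_fin]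

lemma coupledDAG_eq_orientBy (A : ℕ → ℕ → Ω → Bool) (n : ℕ) (ω : Ω) :
    coupledDAG A n ω = orientBy (arraySkeleton (fun i j => A i j ω) 1) 1 := by
  rw [orientBy_arraySkeleton]
  rfl

lemma coupledDAG_last_not_adj (A : ℕ → ℕ → Ω → Bool) (n : ℕ) (ω : Ω) (b : Fin (n + 1)) :
    ¬ (coupledDAG A (n + 1) ω).Adj (Fin.last n) b := fun h => (Fin.le_last b).not_gt h.1

lemma comap_castSucc_coupledDAG (A : ℕ → ℕ → Ω → Bool) (n : ℕ) (ω : Ω) :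
    (coupledDAG A (n + 1) ω).comap Fin.castSucc = coupledDAG A n ω := rfl

lemma mem_shieldedParents_coupledDAG {ω : Ω} {u : Fin n} :
    u ∈ (coupledDAG A (n + 1) ω).shieldedParents ↔ A u n ω = true ∧
      ∀ w : Fin n, w ≠ u →
        ¬ (A w n ω = true ∧ A (min w u : Fin n) (max w u : Fin n) ω = false) := by
  have hlast : ∀ w : Fin n,
      (coupledDAG A (n + 1) ω).Adj w.castSucc (Fin.last n) ↔ A w n ω = true := fun w =>
    ⟨fun h => h.2, fun h => ⟨Fin.castSucc_lt_last w, h⟩⟩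
  have hadj : ∀ v w : Fin n,
      (coupledDAG A (n + 1) ω).Adj v.castSucc w.castSucc ↔ v < w ∧ A v w ω = true :=
    fun _ _ => Iff.rfl
  simp only [DAG.shieldedParents, Set.mem_ofPred_eq, hlast, hadj]
  refine and_congr Iff.rfl (forall_congr' fun w => forall_congr' fun hw => ?_)
  rcases lt_or_gt_of_ne hw with h | h
  · simp [h, h.not_gt, min_eq_left h.le, max_eq_right h.le]
  · simp [h, h.not_gt, min_eq_right h.le, max_eq_left h.le]

variable [MeasurableSpace Ω] {P : Measure Ω} {ρ : unitInterval}

lemma IsEdgeArray.measurableSet (hA : IsEdgeArray P ρ A) {i j : ℕ} (h : i < j) (b : Bool) :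
    MeasurableSet {ω | A i j ω = b} :=
  hA.measurable i j h (measurableSet_singleton b)

lemma IsEdgeArray.real_true (hA : IsEdgeArray P ρ A) {i j : ℕ} (h : i < j) :
    P.real {ω | A i j ω = true} = ρ := by
  rw [measureReal_def, hA.prob i j h, ENNReal.toReal_ofReal ρ.2.1]

lemma IsEdgeArray.measurable_arraySkeleton (hA : IsEdgeArray P ρ A) (σ : Equiv.Perm (Fin n)) :
    Measurable fun ω => arraySkeleton (fun i j => A i j ω) σ := by
  rw [SimpleGraph.measurable_iff_adj]
  intro u v
  have key : ∀ a b : Fin n, MeasurableSet {ω | a < b ∧ A a b ω = true} := by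
    intro a b
    by_cases hab : a < b
    · simpa [hab] using hA.measurableSet (Fin.lt_def.1 hab) true
    · simp [hab]
  exact measurableSet_setOfPred.1 ((key (σ u) (σ v)).union (key (σ v) (σ u)))

lemma IsEdgeArray.measurable_comp_coupledDAG (hA : IsEdgeArray P ρ A) (f : DAG (Fin n) → ℝ) :
    Measurable fun ω => f (coupledDAG A n ω) := by
  simp_rw [coupledDAG_eq_orientBy]
  exact (measurable_of_finite fun H => f (orientBy H 1)).comp (hA.measurable_arraySkeleton 1)

variable [IsProbabilityMeasure P]

lemma IsEdgeArray.real_false (hA : IsEdgeArray P ρ A) {i j : ℕ} (h : i < j) :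
    P.real {ω | A i j ω = false} = 1 - ρ := by
  have : {ω | A i j ω = false} = {ω | A i j ω = true}ᶜ := by ext ω; simp
  rw [this, probReal_compl_eq_one_sub (hA.measurableSet h true), hA.real_true h]

/-- Whatever the order of the vertices, the skeleton is an Erdős-Rényi graph. -/
lemma IsEdgeArray.map_arraySkeleton (hA : IsEdgeArray P ρ A) (σ : Equiv.Perm (Fin n)) :
    P.map (fun ω => arraySkeleton (fun i j => A i j ω) σ) =
      SimpleGraph.binomialRandom (Fin n) ρ := by
  classical
  refine Measure.ext_of_singleton fun H => ?_
  rw [SimpleGraph.binomialRandom_singleton,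
    Measure.map_apply (hA.measurable_arraySkeleton σ) (measurableSet_singleton H)]
  set b : {p : Fin n × Fin n // p.1 < p.2} → Bool := fun p =>
    decide (H.Adj (σ.symm p.1.1) (σ.symm p.1.2)) with hb
  have hset : (fun ω => arraySkeleton (fun i j => A i j ω) σ) ⁻¹' {H} =
      ⋂ p : {p : Fin n × Fin n // p.1 < p.2}, {ω | A p.1.1 p.1.2 ω = b p} := by
    ext ω
    simp only [Set.mem_preimage, Set.mem_singleton_iff, Set.mem_iInter, Set.mem_ofPred_eq]
    constructor
    · rintro rfl ⟨⟨i, j⟩, hij⟩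
      have hij' : i < j := hij
      simp [hb, arraySkeleton, hij', hij'.not_gt]
    · intro h
      have h' : ∀ i j : Fin n, i < j → (A i j ω = true ↔ H.Adj (σ.symm i) (σ.symm j)) := by
        intro i j hij
        have := h ⟨(i, j), hij⟩
        simp only [hb] at this
        rw [this, decide_eq_true_iff]
      ext u v
      change (σ u < σ v ∧ _) ∨ (σ v < σ u ∧ _) ↔ _
      rcases lt_trichotomy (σ u) (σ v) with huv | huv | huv
      · rw [h' _ _ huv]
        simp [huv, huv.not_gt]
      · rw [σ.injective huv]
        simp
      · rw [h' _ _ huv]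
        simp [huv, huv.not_gt, H.adj_comm]
  set g : {p : Fin n × Fin n // p.1 < p.2} → {p : ℕ × ℕ // p.1 < p.2} := fun p =>
    ⟨(p.1.1, p.1.2), Fin.lt_def.1 p.2⟩ with hg
  have hginj : Function.Injective g := by
    rintro ⟨⟨a, b⟩, _⟩ ⟨⟨c, d⟩, _⟩ h
    simp only [hg, Subtype.mk.injEq, Prod.mk.injEq, Fin.val_inj] at h
    exact Subtype.ext (Prod.ext h.1 h.2)
  have hind := hA.indep.precomp hginj
  have hmul := hind.meas_iInter (s := fun p => {ω | A p.1.1 p.1.2 ω = b p}) fun p =>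
    ⟨{b p}, measurableSet_singleton _, rfl⟩
  rw [hset, hmul]
  have hprob : ∀ p : {p : Fin n × Fin n // p.1 < p.2}, P {ω | A p.1.1 p.1.2 ω = b p} =
      if H.Adj (σ.symm p.1.1) (σ.symm p.1.2) then (unitInterval.toNNReal ρ : ENNReal)
      else (unitInterval.toNNReal (unitInterval.symm ρ) : ENNReal) := by
    intro p
    have hlt := Fin.lt_def.1 p.2
    rw [← ofReal_measureReal]
    by_cases h : H.Adj (σ.symm p.1.1) (σ.symm p.1.2)
    · simp only [hb, h, decide_true, if_true, hA.real_true hlt]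
      exact ENNReal.ofReal_eq_coe_nnreal ρ.2.1
    · simp only [hb, h, decide_false, if_false, hA.real_false hlt]
      exact ENNReal.ofReal_eq_coe_nnreal (unitInterval.symm ρ).2.1
  rw [Finset.prod_congr rfl fun p _ => hprob p, Finset.prod_ite, Finset.prod_const,
    Finset.prod_const, card_filter_adj_eq_ncard_edgeSet]
  congr 2
  have h1 := Finset.card_filter_add_card_filter_not
    (s := (Finset.univ : Finset {p : Fin n × Fin n // p.1 < p.2}))
    (fun p => H.Adj (σ.symm p.1.1) (σ.symm p.1.2))
  rw [card_filter_adj_eq_ncard_edgeSet, Finset.card_univ, card_lt_pairs] at h1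
  rw [Nat.card_eq_fintype_card, Fintype.card_fin]
  omega

lemma IsEdgeArray.integrable_comp_coupledDAG (hA : IsEdgeArray P ρ A) (f : DAG (Fin n) → ℝ) :
    Integrable (fun ω => f (coupledDAG A n ω)) P := by
  obtain ⟨C, hC⟩ := (Set.finite_range fun G => ‖f G‖).bddAbove
  exact Integrable.of_bound (hA.measurable_comp_coupledDAG f).aestronglyMeasurable C
    (ae_of_all _ fun ω => hC ⟨_, rfl⟩)

/-- For a quantity that does not depend on the labels of the vertices, the coupled DAGs have the
same expectation as random order DAGs. -/
lemma IsEdgeArray.orderDAGExp_eq (hA : IsEdgeArray P ρ A) {f : DAG (Fin n) → ℝ}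
    (hf : ∀ (G : DAG (Fin n)) (σ : Equiv.Perm (Fin n)), f (G.comap σ) = f G) :
    orderDAGExp ρ n f = ∫ ω, f (coupledDAG A n ω) ∂P := by
  have key : ∀ σ : Equiv.Perm (Fin n),
      ∫ H, f (orientBy H σ) ∂(SimpleGraph.binomialRandom (Fin n) ρ) =
        ∫ ω, f (coupledDAG A n ω) ∂P := by
    intro σ
    rw [← hA.map_arraySkeleton σ, integral_map (hA.measurable_arraySkeleton σ).aemeasurable
      (measurable_of_finite _).aestronglyMeasurable]
    refine integral_congr_ae (ae_of_all _ fun ω => ?_)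
    change f (orientBy (arraySkeleton _ σ) σ) = _
    rw [orientBy_arraySkeleton, hf]
    rfl
  rw [orderDAGExp, Finset.sum_congr rfl fun σ _ => key σ, Finset.sum_const, Finset.card_univ,
    Fintype.card_perm, Fintype.card_fin, nsmul_eq_mul, mul_div_cancel_left₀]
  exact_mod_cast n.factorial_ne_zero

/-! ### The expected number of shielded parents of a new sink -/

/-- The edge from `u` to a new sink is present with probability `ρ`, and independently each of the
other vertices shields it from a v-structure with probability `1 - ρ * (1 - ρ)`. -/
lemma IsEdgeArray.real_mem_shieldedParents (hA : IsEdgeArray P ρ A) (u : Fin n) :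
    P.real {ω | u ∈ (coupledDAG A (n + 1) ω).shieldedParents} =
      ρ * (1 - ρ * (1 - ρ)) ^ (n - 1) := by
  classical
  set m : {p : ℕ × ℕ // p.1 < p.2} → MeasurableSpace Ω := fun p =>
    MeasurableSpace.comap (A p.1.1 p.1.2) inferInstance with hm
  have hind : iIndep m P := hA.indep.iIndep
  have hmle : ∀ p, m p ≤ ‹MeasurableSpace Ω› := fun p => (hA.measurable _ _ p.2).comap_le
  -- the array entries that decide whether `w` shields the edge from `u`
  have hlt : ∀ w : Fin n, w ≠ u → ((min w u : Fin n) : ℕ) < ((max w u : Fin n) : ℕ) := fun w hw =>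
    Fin.lt_def.1 (min_lt_max.2 hw)
  set S : Fin n → Set {p : ℕ × ℕ // p.1 < p.2} := fun w =>
    {p | p.1 = (w.val, n) ∨ w ≠ u ∧ p.1 = ((min w u : Fin n).val, (max w u : Fin n).val)} with hS
  have hdisj : Pairwise fun v w => Disjoint (S v) (S w) := by
    intro v w hvw
    refine Set.disjoint_left.2 fun p hp hp' => hvw ?_
    have hv := v.2
    have hw := w.2
    have hu := u.2
    ext
    simp only [hS, Set.mem_ofPred_eq, ne_eq, Fin.ext_iff] at hp hp'
    rcases hp with hp | ⟨h1, hp⟩ <;> rcases hp' with hp' | ⟨h2, hp'⟩ <;> rw [hp] at hp' <;>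
      simp only [Prod.mk.injEq, Fin.coe_min, Fin.coe_max] at hp' <;> omega
  set E : Fin n → Set Ω := fun w =>
    if w = u then {ω | A u n ω = true}
    else {ω | A w n ω = true ∧ A (min w u : Fin n) (max w u : Fin n) ω = false}ᶜ with hE
  have hle : ∀ w (p : {p : ℕ × ℕ // p.1 < p.2}), p ∈ S w → m p ≤ ⨆ i ∈ S w, m i :=
    fun w p hp => le_biSup m hp
  have hEm : ∀ w, MeasurableSet[⨆ i ∈ S w, m i] (E w) := by
    intro w
    have h1 : MeasurableSet[⨆ i ∈ S w, m i] {ω | A w n ω = true} :=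
      hle w ⟨(w, n), w.2⟩ (Or.inl rfl) _ ⟨{true}, measurableSet_singleton _, rfl⟩
    by_cases hw : w = u
    · subst hw
      simpa [hE] using h1
    · have h2 : MeasurableSet[⨆ i ∈ S w, m i]
          {ω | A (min w u : Fin n) (max w u : Fin n) ω = false} :=
        hle w ⟨_, hlt w hw⟩ (Or.inr ⟨hw, rfl⟩) _ ⟨{false}, measurableSet_singleton _, rfl⟩
      simp only [hE, hw, if_false]
      exact (h1.inter h2).compl
  have hset : {ω | u ∈ (coupledDAG A (n + 1) ω).shieldedParents} =
      ⋂ w ∈ (Finset.univ : Finset (Fin n)), E w := by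
    ext ω
    simp only [Set.mem_ofPred_eq, mem_shieldedParents_coupledDAG, Finset.mem_univ, Set.iInter_true,
      Set.mem_iInter]
    constructor
    · rintro ⟨h1, h2⟩ w
      by_cases hw : w = u
      · simpa [hE, hw] using h1
      · simp only [hE, hw, if_false]
        exact h2 w hw
    · intro h
      refine ⟨by simpa [hE] using h u, fun w hw => ?_⟩
      have := h w
      simp only [hE, hw, if_false] at this
      exact this
  have hu : P.real (E u) = ρ := by
    simp only [hE, if_true]
    exact hA.real_true u.2
  have hw : ∀ w ∈ Finset.univ.erase u, P.real (E w) = 1 - ρ * (1 - ρ) := by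
    intro w hw
    have hwu := Finset.ne_of_mem_erase hw
    simp only [hE, hwu, if_false]
    have hne : (⟨(w.val, n), w.2⟩ : {p : ℕ × ℕ // p.1 < p.2}) ≠
        ⟨((min w u : Fin n).val, (max w u : Fin n).val), hlt w hwu⟩ := by
      intro h
      have h' := congrArg (fun p : {p : ℕ × ℕ // p.1 < p.2} => p.1.2) h
      exact (max w u).2.ne' h'
    have hi := hA.indep.indepFun hne
    have hmul := hi.measure_inter_preimage_eq_mul {true} {false} (measurableSet_singleton _)
      (measurableSet_singleton _)
    have hmul' : P.real {ω | A w n ω = true ∧ A (min w u : Fin n) (max w u : Fin n) ω = false} =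
        P.real {ω | A w n ω = true} *
          P.real {ω | A (min w u : Fin n) (max w u : Fin n) ω = false} := by
      simp only [measureReal_def, ← ENNReal.toReal_mul]
      exact congrArg ENNReal.toReal hmul
    have hEv : MeasurableSet
        {ω | A w n ω = true ∧ A (min w u : Fin n) (max w u : Fin n) ω = false} :=
      (hA.measurableSet w.2 true).inter (hA.measurableSet (hlt w hwu) false)
    rw [probReal_compl_eq_one_sub hEv, hmul',
      hA.real_true w.2, hA.real_false (hlt w hwu)]
  rw [hset, hind.measureReal_biInter_of_pairwise_disjoint hmle hdisj hEm,
    ← Finset.mul_prod_erase _ _ (Finset.mem_univ u), hu, Finset.prod_congr rfl hw,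
    Finset.prod_const, Finset.card_erase_of_mem (Finset.mem_univ u), Finset.card_univ,
    Fintype.card_fin]

lemma IsEdgeArray.integral_ncard_shieldedParents (hA : IsEdgeArray P ρ A) (n : ℕ) :
    ∫ ω, ((coupledDAG A (n + 1) ω).shieldedParents.ncard : ℝ) ∂P = gapTerm ρ n := by
  classical
  have hms : ∀ u : Fin n, MeasurableSet {ω | u ∈ (coupledDAG A (n + 1) ω).shieldedParents} := by
    intro u
    have := hA.measurable_comp_coupledDAG (n := n + 1)
      (fun G => if u ∈ G.shieldedParents then 1 else 0) (measurableSet_singleton 1)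
    convert this using 1
    ext ω
    by_cases h : u ∈ (coupledDAG A (n + 1) ω).shieldedParents <;> simp [h]
  have hsum : ∀ ω, ((coupledDAG A (n + 1) ω).shieldedParents.ncard : ℝ) =
      ∑ u : Fin n, {ω | u ∈ (coupledDAG A (n + 1) ω).shieldedParents}.indicator
        (fun _ => (1 : ℝ)) ω := by
    intro ω
    rw [Set.ncard_eq_toFinset_card']
    simp [Set.indicator_apply, Finset.sum_boole]
  simp_rw [hsum]
  rw [integral_finsetSum _ fun u _ => (integrable_const (1 : ℝ)).indicator (hms u)]
  have hone : ∀ u : Fin n, ∫ ω, {ω | u ∈ (coupledDAG A (n + 1) ω).shieldedParents}.indicator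
      (fun _ => (1 : ℝ)) ω ∂P = ρ * (1 - ρ * (1 - ρ)) ^ (n - 1) := fun u => by
    rw [integral_indicator (hms u), setIntegral_const, smul_eq_mul, mul_one,
      hA.real_mem_shieldedParents]
  rw [Finset.sum_congr rfl fun u _ => hone u, Finset.sum_const, Finset.card_univ, Fintype.card_fin,
    nsmul_eq_mul, gapTerm]
  ring

end Law

/-! ### The limits of the metrics -/

namespace DAG

variable {n : ℕ} {G : DAG (Fin (n + 1))}

lemma isuEss_le_comap (hG : ∀ b, ¬ G.Adj (Fin.last n) b) (r : ℕ) :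
    G.isuEss r ≤ (G.comap Fin.castSucc).isuEss r := by
  have h := minUnoriented_comap_le hG r
  unfold isuEss
  split_ifs <;> omega

lemma isuEss_comap_le_add (hG : ∀ b, ¬ G.Adj (Fin.last n) b) (r : ℕ) :
    (G.comap Fin.castSucc).isuEss r ≤ G.isuEss r + G.shieldedParents.ncard := by
  have h := minUnoriented_le_add hG r
  unfold isuEss
  split_ifs <;> omega

end DAG

section Limits

variable {Ω : Type*}

lemma monotone_of_comap_le {α : Type*} [Preorder α] {f : ∀ n, DAG (Fin n) → α}
    (h : ∀ n (G : DAG (Fin (n + 1))), (∀ b, ¬ G.Adj (Fin.last n) b) →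
      f n (G.comap Fin.castSucc) ≤ f (n + 1) G) (A : ℕ → ℕ → Ω → Bool) (ω : Ω) :
    Monotone fun n => f n (coupledDAG A n ω) :=
  monotone_nat_of_le_succ fun n => h n _ (coupledDAG_last_not_adj A n ω)

variable [MeasurableSpace Ω] {P : Measure Ω} [IsProbabilityMeasure P] {ρ : unitInterval}
  {A : ℕ → ℕ → Ω → Bool}

/-- A metric that changes by at most the number of shielded parents when a sink is added converges
almost surely, and its expectations converge at the rate `gapSum ρ`. -/
lemma IsEdgeArray.exists_isLimitMetric (hA : IsEdgeArray P ρ A) (hρ₀ : 0 < (ρ : ℝ))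
    (hρ₁ : (ρ : ℝ) < 1) {f : ∀ n, DAG (Fin n) → ℝ}
    (hf : ∀ n (G : DAG (Fin n)) (σ : Equiv.Perm (Fin n)), f n (G.comap σ) = f n G)
    (hinc : ∀ n (G : DAG (Fin (n + 1))), (∀ b, ¬ G.Adj (Fin.last n) b) →
      |f (n + 1) G - f n (G.comap Fin.castSucc)| ≤ G.shieldedParents.ncard) :
    ∃ F : Ω → ℝ, IsLimitMetric P A f F ∧ Integrable F P ∧
      ∀ n, |∫ ω, F ω ∂P - orderDAGExp ρ n (f n)| ≤ gapSum ρ n := by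
  have hs : Summable (gapTerm ρ) := by
    simpa using (hasSum_gapTerm hρ₀ hρ₁ 0).summable
  obtain ⟨F, h1, h2, h3⟩ := exists_ae_limit_of_summable_increments (P := P)
    (f := fun n ω => f n (coupledDAG A n ω))
    (D := fun n ω => ((coupledDAG A (n + 1) ω).shieldedParents.ncard : ℝ)) (g := gapTerm ρ)
    (fun n => hA.integrable_comp_coupledDAG _)
    (fun n => hA.integrable_comp_coupledDAG fun G => (G.shieldedParents.ncard : ℝ))
    (fun n ω => hinc n _ (coupledDAG_last_not_adj A n ω))
    (fun n => (hA.integral_ncard_shieldedParents n).le) hs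
  refine ⟨F, h1, h2, fun n => ?_⟩
  rw [hA.orderDAGExp_eq (hf n)]
  exact h3 n

lemma IsEdgeArray.ae_eventually_shieldedParents_eq_empty (hA : IsEdgeArray P ρ A)
    (hρ₀ : 0 < (ρ : ℝ)) (hρ₁ : (ρ : ℝ) < 1) :
    ∀ᵐ ω ∂P, ∀ᶠ n in atTop, (coupledDAG A (n + 1) ω).shieldedParents = ∅ := by
  have hs : Summable fun n => ∫ ω, ((coupledDAG A (n + 1) ω).shieldedParents.ncard : ℝ) ∂P := by
    simp_rw [hA.integral_ncard_shieldedParents]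
    simpa using (hasSum_gapTerm hρ₀ hρ₁ 0).summable
  filter_upwards [(ae_summable_and_integrable_tsum (fun n ω => Nat.cast_nonneg _)
    (fun n => hA.integrable_comp_coupledDAG fun G => (G.shieldedParents.ncard : ℝ)) hs).1] with ω hω
  filter_upwards [hω.tendsto_atTop_zero.eventually_lt_const zero_lt_one] with n hn
  have h0 : (coupledDAG A (n + 1) ω).shieldedParents.ncard < 1 := by exact_mod_cast hn
  exact (Set.ncard_eq_zero (Set.toFinite _)).1 (by omega)

/-- A metric that eventually does not change when a sink without shielded parents is added has an
almost sure limit. -/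
lemma IsEdgeArray.exists_isLimitMetric_of_eq (hA : IsEdgeArray P ρ A) (hρ₀ : 0 < (ρ : ℝ))
    (hρ₁ : (ρ : ℝ) < 1) {f : ∀ n, DAG (Fin n) → ℝ} (N : ℕ)
    (heq : ∀ n, N ≤ n → ∀ G : DAG (Fin (n + 1)), (∀ b, ¬ G.Adj (Fin.last n) b) →
      G.shieldedParents = ∅ → f (n + 1) G = f n (G.comap Fin.castSucc)) :
    ∃ F : Ω → ℝ, IsLimitMetric P A f F := by
  refine ⟨fun ω => limUnder atTop fun n => f n (coupledDAG A n ω), ?_⟩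
  filter_upwards [hA.ae_eventually_shieldedParents_eq_empty hρ₀ hρ₁] with ω hω
  obtain ⟨K, hK⟩ := eventually_atTop.1 hω
  refine tendsto_nhds_limUnder ⟨f (max K N) (coupledDAG A (max K N) ω), ?_⟩
  refine tendsto_atTop_of_eventually_const (i₀ := max K N) fun n hn => ?_
  induction n, hn using Nat.le_induction with
  | base => rfl
  | succ n hn ih =>
    rw [heq n ((le_max_right _ _).trans hn) _ (coupledDAG_last_not_adj A n ω)
      (hK n ((le_max_left _ _).trans hn)), comap_castSucc_coupledDAG, ih]

lemma IsEdgeArray.orderDAGExp_le_integral (hA : IsEdgeArray P ρ A) {f : ∀ n, DAG (Fin n) → ℝ}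
    (hf : ∀ n (G : DAG (Fin n)) (σ : Equiv.Perm (Fin n)), f n (G.comap σ) = f n G)
    (h : ∀ n (G : DAG (Fin (n + 1))), (∀ b, ¬ G.Adj (Fin.last n) b) →
      f n (G.comap Fin.castSucc) ≤ f (n + 1) G)
    {F : Ω → ℝ} (hF : IsLimitMetric P A f F) (hFi : Integrable F P) (n : ℕ) :
    orderDAGExp ρ n (f n) ≤ ∫ ω, F ω ∂P := by
  rw [hA.orderDAGExp_eq (hf n)]
  refine integral_mono_ae (hA.integrable_comp_coupledDAG _) hFi ?_
  filter_upwards [hF] with ω hω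
  exact (monotone_of_comap_le h A ω).ge_of_tendsto hω n

lemma IsEdgeArray.integral_le_orderDAGExp (hA : IsEdgeArray P ρ A) {f : ∀ n, DAG (Fin n) → ℝ}
    (hf : ∀ n (G : DAG (Fin n)) (σ : Equiv.Perm (Fin n)), f n (G.comap σ) = f n G)
    (h : ∀ n (G : DAG (Fin (n + 1))), (∀ b, ¬ G.Adj (Fin.last n) b) →
      f (n + 1) G ≤ f n (G.comap Fin.castSucc))
    {F : Ω → ℝ} (hF : IsLimitMetric P A f F) (hFi : Integrable F P) (n : ℕ) :
    ∫ ω, F ω ∂P ≤ orderDAGExp ρ n (f n) := by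
  rw [hA.orderDAGExp_eq (hf n)]
  refine integral_mono_ae hFi (hA.integrable_comp_coupledDAG _) ?_
  filter_upwards [hF] with ω hω
  exact (antitone_nat_of_succ_le fun n => h n _ (coupledDAG_last_not_adj A n ω)).le_of_tendsto hω n

/-- Limits of class sizes that lie between the minimal class size and two to the minimal number of
unoriented edges. -/
lemma IsEdgeArray.logb_limit_classSize (hA : IsEdgeArray P ρ A) {r : ℕ} {Xinf M : Ω → ℝ}
    (hX : IsLimitMetric P A (fun _ G => (G.minUnoriented r : ℝ)) Xinf) (hXi : Integrable Xinf P)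
    {c : ∀ n, DAG (Fin n) → ℕ} (hc : ∀ n (G : DAG (Fin n)), G.minClassSize r ≤ c n G)
    (hc' : ∀ n (G : DAG (Fin n)), c n G ≤ 2 ^ G.minUnoriented r)
    (hM : IsLimitMetric P A (fun n G => (c n G : ℝ)) M) :
    (∀ᵐ ω ∂P, 1 ≤ M ω) ∧ Integrable (fun ω => Real.logb 2 (M ω)) P ∧
      (∀ n : ℕ, orderDAGExp ρ n (fun G => Real.logb 2 (G.minClassSize r : ℝ)) ≤
        ∫ ω, Real.logb 2 (M ω) ∂P) ∧
      ∫ ω, Real.logb 2 (M ω) ∂P ≤ ∫ ω, Xinf ω ∂P := by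
  have hle : ∀ᵐ ω ∂P, ∀ n, ((coupledDAG A n ω).minClassSize r : ℝ) ≤ M ω := by
    filter_upwards [hM] with ω hω n
    refine ge_of_tendsto hω (eventually_atTop.2 ⟨n, fun m hm => ?_⟩)
    exact_mod_cast (monotone_of_comap_le (f := fun _ G => G.minClassSize r)
      (fun n G hG => DAG.minClassSize_comap_le hG r) A ω hm).trans (hc m _)
  have hone : ∀ᵐ ω ∂P, 1 ≤ M ω := by
    filter_upwards [hle] with ω hω
    exact le_trans (by exact_mod_cast DAG.one_le_minClassSize _ r) (hω 0)
  have hlog : ∀ᵐ ω ∂P, Real.logb 2 (M ω) ≤ Xinf ω := by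
    filter_upwards [hM, hX, hone] with ω h1 h2 h3
    rw [Real.logb_le_iff_le_rpow one_lt_two (by linarith)]
    refine le_of_tendsto_of_tendsto' h1
      (((Real.continuous_const_rpow two_ne_zero).tendsto _).comp h2) fun n => ?_
    rw [Function.comp_apply, Real.rpow_natCast]
    exact_mod_cast hc' n _
  have hMm : AEMeasurable M P :=
    aemeasurable_of_tendsto_metrizable_ae atTop
      (fun n => (hA.measurable_comp_coupledDAG (fun G => (c n G : ℝ))).aemeasurable) hM
  have hint : Integrable (fun ω => Real.logb 2 (M ω)) P := by
    refine hXi.mono'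
      ((Real.measurable_log.comp_aemeasurable hMm).div_const _).aestronglyMeasurable ?_
    filter_upwards [hlog, hone] with ω h1 h2
    rwa [Real.norm_of_nonneg (Real.logb_nonneg one_lt_two h2)]
  refine ⟨hone, hint, fun n => ?_, integral_mono_ae hint hXi hlog⟩
  rw [hA.orderDAGExp_eq fun G σ => by rw [DAG.minClassSize_comap_equiv]]
  refine integral_mono_ae
    (hA.integrable_comp_coupledDAG fun G => Real.logb 2 (G.minClassSize r : ℝ)) hint ?_
  filter_upwards [hle] with ω hω
  refine Real.logb_le_logb_of_le one_lt_two ?_ (hω n)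
  exact_mod_cast DAG.one_le_minClassSize _ r

end Limits

end

theorem theorem1 (ρ : unitInterval) (hρ₀ : 0 < (ρ : ℝ)) (hρ₁ : (ρ : ℝ) < 1)
    {Ω : Type*} [MeasurableSpace Ω] (P : Measure Ω) [IsProbabilityMeasure P]
    (A : ℕ → ℕ → Ω → Bool) (hA : IsEdgeArray P ρ A) :
    -- the error terms
    (∀ n : ℕ, Summable (fun k : ℕ => gapTerm ρ (n + k)) ∧ gapSum ρ n ≤ gapBound ρ n) ∧
    (∃ C q : ℝ, 0 < q ∧ q < 1 ∧ ∀ n : ℕ, gapBound ρ n ≤ C * q ^ n) ∧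
    -- the number of interventions for full orientation
    (∃ Iinf : Ω → ℝ,
      IsLimitMetric P A (fun _ G => (G.numInterventions : ℝ)) Iinf ∧ Integrable Iinf P ∧
      ∀ n : ℕ,
        orderDAGExp ρ n (fun G => (G.numInterventions : ℝ)) ≤ ∫ ω, Iinf ω ∂P ∧
        ∫ ω, Iinf ω ∂P ≤ orderDAGExp ρ n (fun G => (G.numInterventions : ℝ)) + gapSum ρ n) ∧
    -- the metrics after `r` interventions
    ∀ r : ℕ, ∃ Xinf Linf Uinf : Ω → ℝ,
      (IsLimitMetric P A (fun _ G => (G.minUnoriented r : ℝ)) Xinf ∧ Integrable Xinf P ∧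
        ∀ n : ℕ,
          orderDAGExp ρ n (fun G => (G.minUnoriented r : ℝ)) ≤ ∫ ω, Xinf ω ∂P ∧
          ∫ ω, Xinf ω ∂P ≤ orderDAGExp ρ n (fun G => (G.minUnoriented r : ℝ)) + gapSum ρ n) ∧
      (IsLimitMetric P A (fun _ G => (G.minClassSize r : ℝ)) Linf ∧
        (∀ᵐ ω ∂P, 1 ≤ Linf ω) ∧ Integrable (fun ω => Real.logb 2 (Linf ω)) P ∧
        (∀ n : ℕ, orderDAGExp ρ n (fun G => Real.logb 2 (G.minClassSize r : ℝ)) ≤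
          ∫ ω, Real.logb 2 (Linf ω) ∂P) ∧
        ∫ ω, Real.logb 2 (Linf ω) ∂P ≤ ∫ ω, Xinf ω ∂P) ∧
      -- class sizes for sets of interventions that leave the fewest unoriented edges
      ((∃ (S : ∀ n, DAG (Fin n) → Finset (Fin n)) (M : Ω → ℝ),
          (∀ n (G : DAG (Fin n)), G.IsEdgeOptimal r (S n G)) ∧
          IsLimitMetric P A (fun n G => (G.classSize (S n G) : ℝ)) M) ∧
        ∀ (S : ∀ n, DAG (Fin n) → Finset (Fin n)) (M : Ω → ℝ),
          (∀ n (G : DAG (Fin n)), G.IsEdgeOptimal r (S n G)) →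
          IsLimitMetric P A (fun n G => (G.classSize (S n G) : ℝ)) M →
          (∀ᵐ ω ∂P, Linf ω ≤ M ω) ∧ Integrable (fun ω => Real.logb 2 (M ω)) P ∧
          (∀ n : ℕ, orderDAGExp ρ n (fun G => Real.logb 2 (G.minClassSize r : ℝ)) ≤
            ∫ ω, Real.logb 2 (M ω) ∂P) ∧
          ∫ ω, Real.logb 2 (M ω) ∂P ≤ ∫ ω, Xinf ω ∂P) ∧
      (IsLimitMetric P A (fun _ G => (G.isuEss r : ℝ)) Uinf ∧ Integrable Uinf P ∧
        ∀ n : ℕ,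
          ∫ ω, Uinf ω ∂P ≤ orderDAGExp ρ n (fun G => (G.isuEss r : ℝ)) ∧
          orderDAGExp ρ n (fun G => (G.isuEss r : ℝ)) - gapSum ρ n ≤ ∫ ω, Uinf ω ∂P) := by
  have abs_sub_le : ∀ {a b d : ℕ}, b ≤ a → a ≤ b + d → |(a : ℝ) - b| ≤ d := fun {a b d} h1 h2 => by
    have h1' : (b : ℝ) ≤ a := by exact_mod_cast h1
    have h2' : (a : ℝ) ≤ b + d := by exact_mod_cast h2
    rw [abs_of_nonneg (by linarith)]
    linarith
  refine ⟨fun n => ?_, exists_gapBound_le hρ₀ hρ₁, ?_, fun r => ?_⟩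
  · have h := hasSum_gapTerm hρ₀ hρ₁ n
    exact ⟨h.summable, h.tsum_eq.le⟩
  · have hinv : ∀ n (G : DAG (Fin n)) (σ : Equiv.Perm (Fin n)),
        ((G.comap σ).numInterventions : ℝ) = G.numInterventions := fun n G σ => by
      rw [DAG.numInterventions_comap_equiv]
    obtain ⟨F, h1, h2, h3⟩ := hA.exists_isLimitMetric hρ₀ hρ₁
      (f := fun _ G => (G.numInterventions : ℝ)) hinv fun n G hG =>
      abs_sub_le (DAG.numInterventions_comap_le hG) (DAG.numInterventions_le_add hG)
    refine ⟨F, h1, h2, fun n => ⟨?_, ?_⟩⟩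
    · exact hA.orderDAGExp_le_integral hinv
        (fun n G hG => by exact_mod_cast DAG.numInterventions_comap_le hG) h1 h2 n
    · linarith [(abs_le.1 (h3 n)).2]
  · have hinvX : ∀ n (G : DAG (Fin n)) (σ : Equiv.Perm (Fin n)),
        ((G.comap σ).minUnoriented r : ℝ) = G.minUnoriented r := fun n G σ => by
      rw [DAG.minUnoriented_comap_equiv]
    have hinvU : ∀ n (G : DAG (Fin n)) (σ : Equiv.Perm (Fin n)),
        ((G.comap σ).isuEss r : ℝ) = G.isuEss r := fun n G σ => by
      rw [DAG.isuEss_comap_equiv]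
    obtain ⟨X, hX1, hX2, hX3⟩ := hA.exists_isLimitMetric hρ₀ hρ₁
      (f := fun _ G => (G.minUnoriented r : ℝ)) hinvX fun n G hG =>
      abs_sub_le (DAG.minUnoriented_comap_le hG r) (DAG.minUnoriented_le_add hG r)
    obtain ⟨U, hU1, hU2, hU3⟩ := hA.exists_isLimitMetric hρ₀ hρ₁
      (f := fun _ G => (G.isuEss r : ℝ)) hinvU fun n G hG => by
      rw [abs_sub_comm]
      exact abs_sub_le (DAG.isuEss_le_comap hG r) (DAG.isuEss_comap_le_add hG r)
    obtain ⟨L, hL⟩ := hA.exists_isLimitMetric_of_eq hρ₀ hρ₁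
      (f := fun _ G => (G.minClassSize r : ℝ)) 0
      fun n _ G hG h0 => by rw [DAG.minClassSize_eq_comap hG h0]
    refine ⟨X, L, U, ⟨hX1, hX2, fun n => ⟨?_, ?_⟩⟩, ⟨hL, ?_⟩, ⟨?_, ?_⟩,
      ⟨hU1, hU2, fun n => ⟨?_, ?_⟩⟩⟩
    · exact hA.orderDAGExp_le_integral hinvX
        (fun n G hG => by exact_mod_cast DAG.minUnoriented_comap_le hG r) hX1 hX2 n
    · linarith [(abs_le.1 (hX3 n)).2]
    · exact hA.logb_limit_classSize hX1 hX2 (fun _ _ => le_rfl)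
        (fun _ G => G.minClassSize_le_two_pow r) hL
    · -- among the edge-optimal sets, one with the smallest class
      choose S hS hS' using fun n (G : DAG (Fin n)) =>
        G.exists_classSize_eq_minEdgeOptimalClassSize r
      obtain ⟨M, hM⟩ := hA.exists_isLimitMetric_of_eq hρ₀ hρ₁
        (f := fun n G => (G.classSize (S n G) : ℝ)) r fun n hn G hG h0 => by
          rw [hS', hS', DAG.minEdgeOptimalClassSize_eq_comap hG h0 hn]
      exact ⟨S, M, hS, hM⟩
    · intro S M hS hM
      refine ⟨?_, (hA.logb_limit_classSize hX1 hX2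
        (fun n G => DAG.minClassSize_le (hS n G).1)
        (fun n G => (hS n G).classSize_le_two_pow) hM).2⟩
      filter_upwards [hL, hM] with ω h1 h2
      exact le_of_tendsto_of_tendsto' h1 h2 fun n => by
        exact_mod_cast DAG.minClassSize_le (hS n _).1
    · exact hA.integral_le_orderDAGExp hinvU
        (fun n G hG => by exact_mod_cast DAG.isuEss_le_comap hG r) hU1 hU2 n
    · linarith [(abs_le.1 (hU3 n)).1]
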